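/- Let $Q$ be multiplication by $x$ and $P=-i\,d/dx$ in $L^2(\mathbb R)$, and for bounded measurable $f,g:\mathbb R\to\mathbb R$ let $K=i[f(P),g(Q)]$. For $a>0$ let $K_a$ be the set of bounded functions $f:\mathbb R\to\mathbb R$ that have an analytic continuation to the strip $|\mathrm{Im}\,z|<a$ satisfying $\mathrm{Im}\,f(z)\,\mathrm{Im}\,z\ge 0$ there. We say that the Kato conjecture holds for a pair $(f,g)$ of bounded measurable real functions on $\mathbb R$ if $K\ge 0$ and $K\neq 0$ imply that there are $\alpha,\hat\alpha>0$ with $\alpha\hat\alpha=\pi/2$ such that either $f\in K_\alpha$ and $g\in K_{\hat\alpha}$, or $-f\in K_\alpha$ and $-g\in K_{\hat\alpha}$, where in these memberships functions that agree almost everywhere are identified. Theorem. Suppose that the Kato conjecture holds for all pairs $(f,g)$ such that $f$ and $g$ are restrictions to $\mathbb R$ of entire functions and $f\in K_{a'}$, $g\in K_{b'}$ for some $a',b'>0$ (which may depend on the pair). Then the Kato conjecture holds for all pairs $(f,g)$ of bounded measurable functions $f,g:\mathbb R\to\mathbb R$. -/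

import Mathlib

open MeasureTheory
open scoped ENNReal

noncomputable section

namespace KatoCommutator

/-- The complex Hilbert space `L²(ℝ)`, with Lebesgue measure. -/
abbrev L2R : Type := Lp ℂ 2 (volume : Measure ℝ)

/-- Bounded real functions on `ℝ` that are (Lebesgue) measurable. -/
structure BddMeas (f : ℝ → ℝ) : Prop where
  aemeasurable : AEMeasurable f volume
  bounded : ∃ C : ℝ, ∀ x, |f x| ≤ C

theorem BddMeas.memLp {f : ℝ → ℝ} (hf : BddMeas f) :
    MemLp (fun x : ℝ => (f x : ℂ)) ∞ volume := by
  obtain ⟨C, hC⟩ := hf.bounded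
  refine memLp_top_of_bound
    (Complex.measurable_ofReal.comp_aemeasurable hf.aemeasurable).aestronglyMeasurable C ?_
  filter_upwards with x
  simpa using hC x

theorem BddMeas.comp_mul_left {f : ℝ → ℝ} (hf : BddMeas f) {c : ℝ} (hc : c ≠ 0) :
    BddMeas (fun x => f (c * x)) where
  aemeasurable := by
    refine hf.aemeasurable.comp_quasiMeasurePreserving ⟨measurable_const_mul c, ?_⟩
    rw [Real.map_volume_mul_left hc]
    exact Measure.smul_absolutelyContinuous
  bounded := by
    obtain ⟨C, hC⟩ := hf.bounded
    exact ⟨C, fun x => hC _⟩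

/-- The operator `g(Q)` on `L²(ℝ)`: multiplication by the bounded measurable function `g`. -/
def opQ (g : ℝ → ℝ) (hg : BddMeas g) : L2R →L[ℂ] L2R :=
  (ContinuousLinearMap.mul ℂ ℂ).holderL volume ∞ 2 2 hg.memLp.toLp

theorem coeFn_opQ (g : ℝ → ℝ) (hg : BddMeas g) (φ : L2R) :
    opQ g hg φ =ᵐ[volume] fun x => (g x : ℂ) * φ x := by
  have h := (ContinuousLinearMap.mul ℂ ℂ).coeFn_holder (r := 2) hg.memLp.toLp φ
  filter_upwards [h, hg.memLp.coeFn_toLp] with x h1 h2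
  refine h1.trans ?_
  rw [h2]
  rfl

/-- The operator `f(P)` on `L²(ℝ)`, where `P = -i d/dx`. Mathlib's Fourier transform has the kernel
`exp (-2πi x ξ)`, so it turns `P` into multiplication by `2πξ`, and `f(P)` into multiplication by
`f (2πξ)`. -/
def opP (f : ℝ → ℝ) (hf : BddMeas f) : L2R →L[ℂ] L2R :=
  let U : L2R ≃L[ℂ] L2R := (Lp.fourierTransformₗᵢ ℝ ℂ).toContinuousLinearEquiv
  (U.symm : L2R →L[ℂ] L2R) ∘L
    opQ (fun ξ => f (2 * Real.pi * ξ)) (hf.comp_mul_left Real.two_pi_pos.ne') ∘L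
    (U : L2R →L[ℂ] L2R)

/-- The commutator `K = i [f(P), g(Q)]`. -/
def commK (f g : ℝ → ℝ) (hf : BddMeas f) (hg : BddMeas g) : L2R →L[ℂ] L2R :=
  Complex.I • (opP f hf ∘L opQ g hg - opQ g hg ∘L opP f hf)

/-- The class `K_a`: bounded real functions on `ℝ` with an analytic continuation `F` to the strip
`|Im z| < a` that satisfies `Im F(z) * Im z ≥ 0` there. -/
def InK (a : ℝ) (f : ℝ → ℝ) : Prop :=
  (∃ C : ℝ, ∀ x, |f x| ≤ C) ∧
  ∃ F : ℂ → ℂ, DifferentiableOn ℂ F {z : ℂ | |z.im| < a} ∧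
    (∀ x : ℝ, F (x : ℂ) = (f x : ℂ)) ∧
    ∀ z : ℂ, |z.im| < a → 0 ≤ (F z).im * z.im

/-- `f` agrees almost everywhere with a function of the class `K_a`. -/
def AEInK (a : ℝ) (f : ℝ → ℝ) : Prop :=
  ∃ f₀ : ℝ → ℝ, InK a f₀ ∧ f =ᵐ[volume] f₀

/-- `f` is (the restriction to `ℝ` of) an entire function. -/
def IsEntire (f : ℝ → ℝ) : Prop :=
  ∃ F : ℂ → ℂ, Differentiable ℂ F ∧ ∀ x : ℝ, F (x : ℂ) = (f x : ℂ)

/-- The conclusion of the Kato conjecture for the pair `f, g`: for some `α, β > 0` with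
`α β = π / 2`, either `f ∈ K_α` and `g ∈ K_β`, or `-f ∈ K_α` and `-g ∈ K_β`
(the signs are correlated), functions being identified when they agree almost everywhere. -/
def KatoConclusion (f g : ℝ → ℝ) : Prop :=
  ∃ α β : ℝ, 0 < α ∧ 0 < β ∧ α * β = Real.pi / 2 ∧
    ((AEInK α f ∧ AEInK β g) ∨ (AEInK α (fun x => -f x) ∧ AEInK β (fun x => -g x)))

end KatoCommutator

end

/-!
For a state `φ` the quadratic form of `K = i [f(P), g(Q)]` is `∫ g ρ`, where the density
`ρ = 2 Im (conj φ · f(P) φ)` is integrable and has integral zero. Two facts carry the reduction.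

*A positive nonzero commutator has monotone symbols.* Since `f(P)` commutes with translations, the
form at a translated state is `∫ g (x + t) ρ x dx`. Integrate this nonnegative quantity over `t`
against the Cauchy weight `1 / (1 + (t / S)²)`. Because `∫ ρ = 0`, a Taylor expansion of the weight
leaves, as `S → ∞`, the product `M · ∫ x ρ x dx`, where `M` is a limit of average slopes of `g` at
the scale `S` (`abs_average_sub_avgSlope_le`). If `M = 0`, then the form vanishes on Schwartz states
and `K = 0`. If `M ≠ 0`, then `M · ∫ x ρ x dx ≥ 0` for every Schwartz state. On the Fourier side
the first moment of `ρ` is a positive multiple of the weak derivative of `f` paired with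
`|𝓕 φ|²`, which reflects the formal identity `i [f(P), Q] = f'(P)`; hence `f` is monotone up to a
null set, in the direction of the sign of `M` (`exists_monotone_of_form_nonneg`). The Fourier
transform exchanges the roles of `f` and `g` (`form_swap`) and so `g` is monotone in the same
direction (`exists_monotone_pair`). As `K` does not change when both symbols change sign, both may
be taken to be nondecreasing.

*Monotone symbols can be regularized.* Averaging a symbol over translations, with respect to any
probability measure, keeps the commutator positive (`form_mollify_nonneg`). For the law of the sum
of a Gaussian and a Cauchy variable the regularized symbol is entire, by the Gaussian, and for a
nondecreasing symbol it lies in some class `K_a`, by the Cauchy kernel (`inK_mollify_cauchy`). At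
small scales the commutator is still nonzero, because the symbols converge almost everywhere. The
hypothesis therefore gives strips of widths `α n`, `β n` with `α n * β n = π / 2`.

Finally the classes `K_a` are closed under bounded pointwise limits (`inK_of_tendsto`): a
Harnack-type estimate (`norm_mul_slope_sub_le`) bounds the analytic continuations locally uniformly
by the bound on the real axis, and bounded families of holomorphic functions have holomorphic limits
along an ultrafilter. If both widths have finite limits, these are positive with product `π / 2` and
the conclusion holds for `f` and `g`. Otherwise one of the limiting symbols lies in `K_a` for every
`a`, is therefore constant (`constant_of_forall_inK`), and the commutator vanishes.
-/

noncomputable section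

namespace KatoCommutator

open Filter Topology ComplexConjugate

section

open FourierTransform SchwartzMap

/-! ### The quadratic form of the commutator -/

/-- The unitary Fourier transform on `L²(ℝ)`, with kernel `exp (-2πi x ξ)`. -/
abbrev fourierL2 : L2R ≃ₗᵢ[ℂ] L2R := Lp.fourierTransformₗᵢ ℝ ℂ

/-- The dilated symbol `ξ ↦ f (2πξ)`: conjugated by the Fourier transform, `f(P)` becomes
multiplication by it. -/
def dilate (f : ℝ → ℝ) : ℝ → ℝ := fun ξ => f (2 * Real.pi * ξ)

theorem BddMeas.dilate {f : ℝ → ℝ} (hf : BddMeas f) : BddMeas (dilate f) :=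
  hf.comp_mul_left Real.two_pi_pos.ne'

theorem opP_apply {f : ℝ → ℝ} (hf : BddMeas f) (φ : L2R) :
    opP f hf φ = fourierL2.symm (opQ (dilate f) hf.dilate (fourierL2 φ)) := rfl

/-- The quadratic form `φ ↦ ⟨φ, K φ⟩` of the commutator `K = i [f(P), g(Q)]`,
written without the commutator. -/
def form (f g : ℝ → ℝ) (hf : BddMeas f) (hg : BddMeas g) (φ : L2R) : ℝ :=
  2 * (inner ℂ (opQ g hg φ) (opP f hf φ)).im

theorem inner_opQ_comm {g : ℝ → ℝ} (hg : BddMeas g) (φ ψ : L2R) :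
    inner ℂ (opQ g hg φ) ψ = inner ℂ φ (opQ g hg ψ) := by
  rw [L2.inner_def, L2.inner_def]
  refine integral_congr_ae ?_
  filter_upwards [coeFn_opQ g hg φ, coeFn_opQ g hg ψ] with x h1 h2
  simp only [h1, h2, RCLike.inner_apply, map_mul, Complex.conj_ofReal]
  ring

theorem inner_opP_comm {f : ℝ → ℝ} (hf : BddMeas f) (φ ψ : L2R) :
    inner ℂ (opP f hf φ) ψ = inner ℂ φ (opP f hf ψ) := by
  rw [opP_apply, opP_apply, ← fourierL2.inner_map_map, ← fourierL2.inner_map_map φ]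
  simp only [LinearIsometryEquiv.apply_symm_apply]
  exact inner_opQ_comm _ _ _

theorem inner_commK {f g : ℝ → ℝ} (hf : BddMeas f) (hg : BddMeas g) (φ ψ : L2R) :
    inner ℂ (commK f g hf hg φ) ψ = inner ℂ φ (commK f g hf hg ψ) := by
  simp only [commK, smul_apply, sub_apply,
    ContinuousLinearMap.comp_apply, inner_smul_left, inner_smul_right, inner_sub_left,
    inner_sub_right, inner_opP_comm, inner_opQ_comm, Complex.conj_I]
  ring

theorem inner_commK_self {f g : ℝ → ℝ} (hf : BddMeas f) (hg : BddMeas g) (φ : L2R) :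
    inner ℂ (commK f g hf hg φ) φ = (form f g hf hg φ : ℂ) := by
  have h : inner ℂ (opP f hf φ) (opQ g hg φ) = conj (inner ℂ (opQ g hg φ) (opP f hf φ)) :=
    (inner_conj_symm _ _).symm
  simp only [commK, smul_apply, sub_apply,
    ContinuousLinearMap.comp_apply, inner_smul_left, inner_sub_left, form,
    inner_opP_comm, inner_opQ_comm, Complex.conj_I]
  rw [← inner_opQ_comm hg φ (opP f hf φ), ← inner_opP_comm hf φ (opQ g hg φ), h]
  generalize (inner ℂ (opQ g hg φ) (opP f hf φ) : ℂ) = z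
  apply Complex.ext <;> simp
  ring

theorem commK_isPositive_iff {f g : ℝ → ℝ} (hf : BddMeas f) (hg : BddMeas g) :
    (commK f g hf hg).IsPositive ↔ ∀ φ, 0 ≤ form f g hf hg φ := by
  have h (φ : L2R) : (commK f g hf hg).reApplyInnerSelf φ = form f g hf hg φ := by
    rw [ContinuousLinearMap.reApplyInnerSelf_apply, inner_commK_self]
    simp
  rw [ContinuousLinearMap.isPositive_def]
  simp only [h]
  exact and_iff_right fun φ ψ => inner_commK hf hg φ ψ

theorem commK_eq_zero_iff {f g : ℝ → ℝ} (hf : BddMeas f) (hg : BddMeas g) :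
    commK f g hf hg = 0 ↔ ∀ φ, form f g hf hg φ = 0 := by
  have h := inner_map_self_eq_zero (commK f g hf hg : L2R →ₗ[ℂ] L2R)
  simp only [ContinuousLinearMap.coe_coe, inner_commK_self, Complex.ofReal_eq_zero] at h
  rw [h]
  constructor
  · intro h0
    rw [h0]
    rfl
  · intro h0
    ext1 φ
    exact LinearMap.congr_fun h0 φ

theorem continuous_form {f g : ℝ → ℝ} (hf : BddMeas f) (hg : BddMeas g) :
    Continuous (form f g hf hg) := by
  unfold form
  fun_prop

theorem opQ_congr {g g' : ℝ → ℝ} (hg : BddMeas g) (hg' : BddMeas g') (h : g =ᵐ[volume] g')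
    (φ : L2R) : opQ g hg φ = opQ g' hg' φ := by
  apply Lp.ext
  filter_upwards [coeFn_opQ g hg φ, coeFn_opQ g' hg' φ, h] with x h1 h2 h3
  rw [h1, h2, h3]

theorem quasiMeasurePreserving_mul_left {c : ℝ} (hc : c ≠ 0) :
    Measure.QuasiMeasurePreserving (fun x : ℝ => c * x) volume volume := by
  refine ⟨measurable_const_mul c, ?_⟩
  rw [Real.map_volume_mul_left hc]
  exact Measure.smul_absolutelyContinuous

theorem dilate_congr {f f' : ℝ → ℝ} (h : f =ᵐ[volume] f') : dilate f =ᵐ[volume] dilate f' :=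
  (quasiMeasurePreserving_mul_left Real.two_pi_pos.ne').ae_eq_comp h

theorem form_congr {f f' g g' : ℝ → ℝ} (hf : BddMeas f) (hg : BddMeas g) (hf' : BddMeas f')
    (hg' : BddMeas g') (h : f =ᵐ[volume] f') (h' : g =ᵐ[volume] g') (φ : L2R) :
    form f g hf hg φ = form f' g' hf' hg' φ := by
  unfold form
  rw [opP_apply, opP_apply, opQ_congr hg hg' h', opQ_congr _ hf'.dilate (dilate_congr h)]

theorem BddMeas.neg {f : ℝ → ℝ} (hf : BddMeas f) : BddMeas (fun x => -f x) where
  aemeasurable := hf.aemeasurable.neg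
  bounded := by
    obtain ⟨C, hC⟩ := hf.bounded
    exact ⟨C, fun x => by rw [abs_neg]; exact hC x⟩

theorem opQ_neg {g : ℝ → ℝ} (hg : BddMeas g) (φ : L2R) :
    opQ (fun x => -g x) hg.neg φ = -opQ g hg φ := by
  apply Lp.ext
  filter_upwards [coeFn_opQ g hg φ, coeFn_opQ _ hg.neg φ, Lp.coeFn_neg (opQ g hg φ)] with x h1 h2 h3
  rw [h2, h3, Pi.neg_apply, h1]
  push_cast
  ring

theorem opP_neg {f : ℝ → ℝ} (hf : BddMeas f) (φ : L2R) :
    opP (fun x => -f x) hf.neg φ = -opP f hf φ := by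
  rw [opP_apply, opP_apply, ← map_neg, ← opQ_neg]
  rfl

theorem form_neg_neg {f g : ℝ → ℝ} (hf : BddMeas f) (hg : BddMeas g) (φ : L2R) :
    form (fun x => -f x) (fun x => -g x) hf.neg hg.neg φ = form f g hf hg φ := by
  unfold form
  rw [opP_neg, opQ_neg, inner_neg_neg]

/-- The density `ρ` for which `⟨φ, i [f(P), g(Q)] φ⟩ = ∫ g ρ` for every `g`. -/
def density (f : ℝ → ℝ) (hf : BddMeas f) (φ : L2R) (x : ℝ) : ℝ :=
  2 * (conj (φ x) * opP f hf φ x).im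

theorem integrable_density {f : ℝ → ℝ} (hf : BddMeas f) (φ : L2R) :
    Integrable (density f hf φ) := by
  have h := (L2.integrable_inner (𝕜 := ℂ) φ (opP f hf φ)).im.const_mul 2
  refine h.congr (Eventually.of_forall fun x => ?_)
  simp [density, RCLike.inner_apply, mul_comm]

theorem form_eq_integral {f g : ℝ → ℝ} (hf : BddMeas f) (hg : BddMeas g) (φ : L2R) :
    form f g hf hg φ = ∫ x, g x * density f hf φ x := by
  rw [form, L2.inner_def]
  have h := integral_im (L2.integrable_inner (𝕜 := ℂ) (opQ g hg φ) (opP f hf φ))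
  simp only [RCLike.im_to_complex] at h
  rw [← h, ← integral_const_mul]
  refine integral_congr_ae ?_
  filter_upwards [coeFn_opQ g hg φ] with x h1
  simp only [density, h1, RCLike.inner_apply, map_mul, Complex.conj_ofReal]
  rw [show opP f hf φ x * ((g x : ℂ) * conj (φ x)) = (g x : ℂ) * (conj (φ x) * opP f hf φ x) by ring,
    Complex.im_ofReal_mul]
  ring

/-- Constants commute with every operator. -/
theorem integral_density {f : ℝ → ℝ} (hf : BddMeas f) (φ : L2R) :
    ∫ x, density f hf φ x = 0 := by
  have hone : BddMeas (fun _ => (1 : ℝ)) := ⟨aemeasurable_const, 1, fun x => by simp⟩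
  have h := form_eq_integral hf hone φ
  simp only [one_mul] at h
  rw [← h, form]
  have h1 : opQ _ hone φ = φ := by
    apply Lp.ext
    filter_upwards [coeFn_opQ _ hone φ] with x h1
    simp [h1]
  have h2 : conj (inner ℂ φ (opP f hf φ)) = inner ℂ φ (opP f hf φ) := by
    rw [inner_conj_symm, inner_opP_comm]
  rw [h1, Complex.conj_eq_iff_im.1 h2, mul_zero]

/-! ### Weyl covariance and Fourier symmetry -/

theorem dense_schwartz : DenseRange fun φ : 𝓢(ℝ, ℂ) => φ.toLp 2 volume :=
  SchwartzMap.denseRange_toLpCLM (p := 2) ENNReal.ofNat_ne_top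

theorem fourierL2_toLp (φ : 𝓢(ℝ, ℂ)) : fourierL2 (φ.toLp 2 volume) = (𝓕 φ).toLp 2 volume :=
  φ.toLp_fourier_eq

/-- The translation `φ ↦ φ (· - t)` of `L²(ℝ)`. -/
def translate (t : ℝ) (φ : L2R) : L2R :=
  Lp.compMeasurePreserving (fun x => x - t) (measurePreserving_sub_right volume t) φ

theorem coeFn_translate (t : ℝ) (φ : L2R) : translate t φ =ᵐ[volume] fun x => φ (x - t) :=
  Lp.coeFn_compMeasurePreserving φ (measurePreserving_sub_right volume t)

theorem continuous_translate (t : ℝ) : Continuous (translate t) :=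
  (Lp.isometry_compMeasurePreserving (measurePreserving_sub_right volume t)).continuous

theorem continuous_translate_left (φ : L2R) : Continuous fun t => translate t φ := by
  have := Continuous.compMeasurePreservingLp (p := 2) (μ := (volume : Measure ℝ))
    (ν := (volume : Measure ℝ)) (f := fun _ : ℝ => φ)
    (g := fun t : ℝ => (⟨fun x => x - t, by fun_prop⟩ : C(ℝ, ℝ))) continuous_const
    (ContinuousMap.continuous_of_continuous_uncurry _ (by
      simp only [Function.uncurry_def, ContinuousMap.coe_mk]
      fun_prop))
    (fun t => measurePreserving_sub_right volume t) ENNReal.ofNat_ne_top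
  exact this

theorem fourier_translate_schwartz (t : ℝ) (φ : 𝓢(ℝ, ℂ)) (ξ : ℝ) :
    𝓕 (compSubConstCLM ℂ t φ) ξ = (Real.fourierChar (-(t * ξ)) : ℂ) * 𝓕 φ ξ := by
  rw [fourier_coe, fourier_coe, Real.fourier_real_eq, Real.fourier_real_eq,
    ← integral_const_mul, ← integral_add_right_eq_self _ t]
  refine integral_congr_ae (Eventually.of_forall fun x => ?_)
  simp only [compSubConstCLM_apply, add_sub_cancel_right, Circle.smul_def, smul_eq_mul]
  rw [← mul_assoc, ← Circle.coe_mul, ← AddChar.map_add_eq_mul]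
  congr 4
  ring

theorem translate_toLp (t : ℝ) (φ : 𝓢(ℝ, ℂ)) :
    translate t (φ.toLp 2 volume) = (compSubConstCLM ℂ t φ).toLp 2 volume := by
  apply Lp.ext
  have h := (measurePreserving_sub_right volume t).quasiMeasurePreserving.ae_eq_comp
    (φ.coeFn_toLp 2 volume)
  filter_upwards [coeFn_translate t (φ.toLp 2 volume), h,
    (compSubConstCLM ℂ t φ).coeFn_toLp 2 volume] with x h1 h2 h3
  rw [h1, h3, compSubConstCLM_apply]
  exact h2

/-- The Fourier transform turns a translation into multiplication by a character. -/
theorem fourierL2_translate (t : ℝ) (φ : L2R) :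
    fourierL2 (translate t φ) =ᵐ[volume]
      fun ξ => (Real.fourierChar (-(t * ξ)) : ℂ) * fourierL2 φ ξ := by
  have hχ : MemLp (fun ξ : ℝ => (Real.fourierChar (-(t * ξ)) : ℂ)) ∞ volume := by
    refine memLp_top_of_bound (Continuous.aestronglyMeasurable ?_) 1
      (Eventually.of_forall fun ξ => (Circle.norm_coe _).le)
    exact continuous_subtype_val.comp (Real.continuous_fourierChar.comp (by fun_prop))
  let m : L2R →L[ℂ] L2R := (ContinuousLinearMap.mul ℂ ℂ).holderL volume ∞ 2 2 hχ.toLp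
  have hm (ψ : L2R) : m ψ =ᵐ[volume] fun ξ => (Real.fourierChar (-(t * ξ)) : ℂ) * ψ ξ := by
    have h := (ContinuousLinearMap.mul ℂ ℂ).coeFn_holder (r := 2) hχ.toLp ψ
    filter_upwards [h, hχ.coeFn_toLp] with x h1 h2
    refine h1.trans ?_
    rw [h2]
    rfl
  have key : fourierL2 (translate t φ) = m (fourierL2 φ) := by
    refine dense_schwartz.induction_on (p := fun φ => fourierL2 (translate t φ) = m (fourierL2 φ))
      φ ?_ ?_
    · exact isClosed_eq (fourierL2.continuous.comp (continuous_translate t))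
        (m.continuous.comp fourierL2.continuous)
    · intro ψ
      rw [translate_toLp, fourierL2_toLp, fourierL2_toLp]
      apply Lp.ext
      filter_upwards [hm ((𝓕 ψ).toLp 2 volume), (𝓕 ψ).coeFn_toLp 2 volume,
        (𝓕 (compSubConstCLM ℂ t ψ)).coeFn_toLp 2 volume] with x h1 h2 h3
      rw [h1, h2, h3, fourier_translate_schwartz]
  rw [key]
  exact hm _

theorem opP_translate {f : ℝ → ℝ} (hf : BddMeas f) (t : ℝ) (φ : L2R) :
    opP f hf (translate t φ) = translate t (opP f hf φ) := by
  rw [opP_apply, LinearIsometryEquiv.symm_apply_eq]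
  apply Lp.ext
  filter_upwards [coeFn_opQ (dilate f) hf.dilate (fourierL2 (translate t φ)),
    fourierL2_translate t φ, fourierL2_translate t (opP f hf φ),
    coeFn_opQ (dilate f) hf.dilate (fourierL2 φ)] with x h1 h2 h3 h4
  rw [h1, h2, h3, opP_apply, LinearIsometryEquiv.apply_symm_apply, h4]
  ring

theorem density_translate {f : ℝ → ℝ} (hf : BddMeas f) (t : ℝ) (φ : L2R) :
    density f hf (translate t φ) =ᵐ[volume] fun x => density f hf φ (x - t) := by
  filter_upwards [coeFn_translate t φ, coeFn_translate t (opP f hf φ)] with x h1 h2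
  rw [density, opP_translate, h1, h2, density]

theorem form_translate {f g : ℝ → ℝ} (hf : BddMeas f) (hg : BddMeas g) (t : ℝ) (φ : L2R) :
    form f g hf hg (translate t φ) = ∫ x, g (x + t) * density f hf φ x := by
  rw [form_eq_integral, ← integral_add_right_eq_self _ t]
  have h := (measurePreserving_add_right volume t).quasiMeasurePreserving.ae_eq_comp
    (density_translate hf t φ)
  refine integral_congr_ae ?_
  filter_upwards [h] with x h1
  simp only [Function.comp_apply, add_sub_cancel_right] at h1
  rw [h1]

/-- The reflected symbol `x ↦ -g (-x / 2π)`: exchanging position and momentum by the Fourier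
transform turns the pair `(f, g)` into `(reflect g, dilate f)`. -/
def reflect (g : ℝ → ℝ) : ℝ → ℝ := fun x => -g (-(2 * Real.pi)⁻¹ * x)

theorem neg_inv_two_pi_ne_zero : -(2 * Real.pi)⁻¹ ≠ 0 :=
  neg_ne_zero.2 (inv_ne_zero Real.two_pi_pos.ne')

theorem BddMeas.reflect {g : ℝ → ℝ} (hg : BddMeas g) : BddMeas (reflect g) :=
  (hg.comp_mul_left neg_inv_two_pi_ne_zero).neg

theorem dilate_reflect (g : ℝ → ℝ) : dilate (reflect g) = fun x => -g (-x) := by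
  funext x
  simp only [dilate, reflect]
  congr 2
  field_simp

theorem fourierL2_fourierL2 (φ : L2R) :
    fourierL2 (fourierL2 φ) =ᵐ[volume] fun x => φ (-x) := by
  have hn : MeasurePreserving (fun x : ℝ => -x) volume volume := Measure.measurePreserving_neg _
  have key : fourierL2 (fourierL2 φ) = Lp.compMeasurePreserving (fun x : ℝ => -x) hn φ := by
    refine dense_schwartz.induction_on
      (p := fun φ => fourierL2 (fourierL2 φ) = Lp.compMeasurePreserving (fun x : ℝ => -x) hn φ)
      φ ?_ ?_
    · exact isClosed_eq (fourierL2.continuous.comp fourierL2.continuous)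
        (Lp.isometry_compMeasurePreserving hn).continuous
    · intro ψ
      rw [fourierL2_toLp, fourierL2_toLp]
      apply Lp.ext
      filter_upwards [(𝓕 (𝓕 ψ)).coeFn_toLp 2 volume,
        Lp.coeFn_compMeasurePreserving (ψ.toLp 2 volume) hn,
        hn.quasiMeasurePreserving.ae_eq_comp (ψ.coeFn_toLp 2 volume)] with x h1 h2 h3
      rw [h1, h2, h3]
      have h4 : 𝓕⁻ (𝓕 ψ) (-x) = ψ (-x) := by rw [FourierTransform.fourierInv_fourier_eq]
      rw [← show 𝓕⁻ (𝓕 ψ) (-x) = (ψ ∘ Neg.neg) x from h4, fourierInv_coe,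
        Real.fourierInv_eq_fourier_neg, neg_neg, fourier_coe]
  rw [key]
  exact Lp.coeFn_compMeasurePreserving φ hn

theorem opP_reflect {g : ℝ → ℝ} (hg : BddMeas g) (φ : L2R) :
    opP (reflect g) hg.reflect (fourierL2 φ) = -fourierL2 (opQ g hg φ) := by
  rw [opP_apply, LinearIsometryEquiv.symm_apply_eq, map_neg]
  apply Lp.ext
  have hn : MeasurePreserving (fun x : ℝ => -x) volume volume := Measure.measurePreserving_neg _
  filter_upwards [coeFn_opQ _ hg.reflect.dilate (fourierL2 (fourierL2 φ)),
    fourierL2_fourierL2 φ, fourierL2_fourierL2 (opQ g hg φ),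
    Lp.coeFn_neg (fourierL2 (fourierL2 (opQ g hg φ))),
    hn.quasiMeasurePreserving.ae_eq_comp (coeFn_opQ g hg φ)] with x h1 h2 h3 h4 h5
  simp only [Function.comp_apply] at h5
  rw [h1, h2, h4, Pi.neg_apply, h3, h5, dilate_reflect]
  push_cast
  ring

/-- Exchanging position and momentum. -/
theorem form_swap {f g : ℝ → ℝ} (hf : BddMeas f) (hg : BddMeas g) (φ : L2R) :
    form f g hf hg φ = form (reflect g) (dilate f) hg.reflect hf.dilate (fourierL2 φ) := by
  rw [form, form, opP_reflect hg, inner_neg_right, ← fourierL2.inner_map_map, opP_apply,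
    LinearIsometryEquiv.apply_symm_apply,
    ← inner_conj_symm (opQ (dilate f) hf.dilate (fourierL2 φ)), Complex.neg_im, Complex.conj_im,
    neg_neg]

/-! ### First moments -/

/-- Multiplication of a Schwartz function by the coordinate. -/
def mulCoord (φ : 𝓢(ℝ, ℂ)) : 𝓢(ℝ, ℂ) := smulLeftCLM ℂ (fun x : ℝ => inner ℝ x (1 : ℝ)) φ

theorem mulCoord_apply (φ : 𝓢(ℝ, ℂ)) (x : ℝ) : mulCoord φ x = x * φ x := by
  rw [mulCoord, smulLeftCLM_apply_apply (by fun_prop)]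
  simp

theorem mul_density_ae_eq_inner {f : ℝ → ℝ} (hf : BddMeas f) (φ φ' : 𝓢(ℝ, ℂ)) {a : ℝ → ℝ}
    (h : ∀ x, φ' x = a x * φ x) :
    (fun x => a x * density f hf (φ.toLp 2 volume) x) =ᵐ[volume]
      fun x => 2 * (inner ℂ (φ'.toLp 2 volume x) (opP f hf (φ.toLp 2 volume) x)).im := by
  filter_upwards [φ.coeFn_toLp 2 volume, φ'.coeFn_toLp 2 volume] with x h1 h2
  rw [density, h1, h2, h, RCLike.inner_apply, map_mul, Complex.conj_ofReal,
    mul_comm (opP f hf _ x), mul_assoc, Complex.im_ofReal_mul]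
  ring

theorem integrable_coord_mul_density {f : ℝ → ℝ} (hf : BddMeas f) (φ : 𝓢(ℝ, ℂ)) :
    Integrable fun x => x * density f hf (φ.toLp 2 volume) x := by
  refine Integrable.congr ?_ (mul_density_ae_eq_inner hf φ (mulCoord φ)
    (fun x => by rw [mulCoord_apply])).symm
  exact (L2.integrable_inner (𝕜 := ℂ) (E := ℂ) _ _).im.const_mul 2

theorem integrable_coord_sq_mul_density {f : ℝ → ℝ} (hf : BddMeas f) (φ : 𝓢(ℝ, ℂ)) :
    Integrable fun x => x ^ 2 * density f hf (φ.toLp 2 volume) x := by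
  refine Integrable.congr ?_ (mul_density_ae_eq_inner hf φ (mulCoord (mulCoord φ))
    (fun x => by rw [mulCoord_apply, mulCoord_apply]; push_cast; ring)).symm
  exact (L2.integrable_inner (𝕜 := ℂ) (E := ℂ) _ _).im.const_mul 2

theorem fourier_mulCoord (φ : 𝓢(ℝ, ℂ)) (ξ : ℝ) :
    (𝓕 (mulCoord φ) : 𝓢(ℝ, ℂ)) ξ = (Complex.I / (2 * Real.pi)) * deriv (𝓕 φ : 𝓢(ℝ, ℂ)) ξ := by
  have h := lineDerivOp_fourier_eq φ (1 : ℝ)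
  have h2 : (LineDeriv.lineDerivOp (1 : ℝ) (𝓕 φ : 𝓢(ℝ, ℂ)) : 𝓢(ℝ, ℂ)) ξ =
      deriv (𝓕 φ : 𝓢(ℝ, ℂ)) ξ := by
    rw [lineDerivOp_apply_eq_fderiv, fderiv_apply_one_eq_deriv]
  rw [← h2, h, ← mulCoord, FourierTransform.fourier_smul, smul_apply, smul_eq_mul]
  have : (Real.pi : ℂ) ≠ 0 := Complex.ofReal_ne_zero.2 Real.pi_ne_zero
  field_simp
  rw [Complex.I_sq]
  ring

/-- The first moment of the density is, up to a constant, the distributional derivative of the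
symbol tested against `|𝓕 φ|²`: formally, `i [f(P), Q] = f'(P)`. -/
theorem integral_coord_mul_density {f : ℝ → ℝ} (hf : BddMeas f) (φ : 𝓢(ℝ, ℂ)) :
    ∫ x, x * density f hf (φ.toLp 2 volume) x =
      -(1 / Real.pi) * ∫ ξ, dilate f ξ * (conj (deriv (𝓕 φ : 𝓢(ℝ, ℂ)) ξ) * (𝓕 φ : 𝓢(ℝ, ℂ)) ξ).re := by
  rw [integral_congr_ae (mul_density_ae_eq_inner hf φ (mulCoord φ)
    (fun x => by rw [mulCoord_apply])), integral_const_mul]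
  have h := integral_im (L2.integrable_inner (𝕜 := ℂ) ((mulCoord φ).toLp 2 volume)
    (opP f hf (φ.toLp 2 volume)))
  simp only [RCLike.im_to_complex] at h
  rw [h, ← L2.inner_def, ← fourierL2.inner_map_map, opP_apply,
    LinearIsometryEquiv.apply_symm_apply, fourierL2_toLp, fourierL2_toLp, L2.inner_def]
  have h' := integral_im (L2.integrable_inner (𝕜 := ℂ) ((𝓕 (mulCoord φ)).toLp 2 volume)
    (opQ (dilate f) hf.dilate ((𝓕 φ).toLp 2 volume)))
  simp only [RCLike.im_to_complex] at h'
  rw [← h', ← integral_const_mul, ← integral_const_mul]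
  refine integral_congr_ae ?_
  filter_upwards [coeFn_opQ (dilate f) hf.dilate ((𝓕 φ).toLp 2 volume),
    (𝓕 φ).coeFn_toLp 2 volume, (𝓕 (mulCoord φ)).coeFn_toLp 2 volume] with ξ h1 h2 h3
  rw [h1, h2, h3, fourier_mulCoord, RCLike.inner_apply]
  simp only [map_mul, map_div₀, Complex.conj_I, Complex.conj_ofReal, map_ofNat]
  rw [show (dilate f ξ : ℂ) * (𝓕 φ : 𝓢(ℝ, ℂ)) ξ *
        (-Complex.I / (2 * Real.pi) * conj (deriv (𝓕 φ : 𝓢(ℝ, ℂ)) ξ))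
      = ((-(dilate f ξ / (2 * Real.pi)) : ℝ) : ℂ) *
        (Complex.I * (conj (deriv (𝓕 φ : 𝓢(ℝ, ℂ)) ξ) * (𝓕 φ : 𝓢(ℝ, ℂ)) ξ)) by push_cast; ring,
    Complex.im_ofReal_mul, Complex.I_mul_im]
  field_simp

/-! ### Averaging over large translations -/

/-- The average increase of `g` over the scale `S`, weighted by `-w'` for the Cauchy weight
`w s = 1 / (1 + s ^ 2)`. -/
def avgSlope (g : ℝ → ℝ) (S : ℝ) : ℝ := ∫ s, 2 * s / (1 + s ^ 2) ^ 2 * g (S * s)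

theorem abs_two_mul_div_le (s : ℝ) : |2 * s / (1 + s ^ 2) ^ 2| ≤ (1 + s ^ 2)⁻¹ := by
  have h : (0 : ℝ) < 1 + s ^ 2 := by positivity
  rw [abs_div, abs_of_pos (pow_pos h 2), div_le_iff₀ (pow_pos h 2)]
  have e : (1 + s ^ 2)⁻¹ * (1 + s ^ 2) ^ 2 = 1 + s ^ 2 := by field_simp
  rw [e, abs_le]
  constructor <;> nlinarith [sq_nonneg (s - 1), sq_nonneg (s + 1)]

theorem integrable_weight_mul {a g : ℝ → ℝ} (ha : Measurable a)
    (hab : ∃ K, ∀ s, |a s| ≤ K * (1 + s ^ 2)⁻¹) (hg : Measurable g) {C : ℝ}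
    (hC : ∀ x, |g x| ≤ C) : Integrable fun s => a s * g s := by
  obtain ⟨K, hK⟩ := hab
  refine Integrable.mono' ((integrable_inv_one_add_sq.const_mul K).mul_const C)
    (ha.mul hg).aestronglyMeasurable (Eventually.of_forall fun s => ?_)
  rw [Real.norm_eq_abs, abs_mul]
  exact mul_le_mul (hK s) (hC s) (abs_nonneg _) ((abs_nonneg _).trans (hK s))

/-- Second order Taylor estimate for the Cauchy weight, uniform in the increment. -/
theorem abs_weight_taylor_le (s h : ℝ) :
    |(1 + (s - h) ^ 2)⁻¹ - (1 + s ^ 2)⁻¹ - h * (2 * s / (1 + s ^ 2) ^ 2)| ≤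
      6 * h ^ 2 * (1 + s ^ 2)⁻¹ := by
  have h1 : (0 : ℝ) < 1 + s ^ 2 := by positivity
  have h2 : (0 : ℝ) < 1 + (s - h) ^ 2 := by positivity
  have e : (1 + (s - h) ^ 2)⁻¹ - (1 + s ^ 2)⁻¹ - h * (2 * s / (1 + s ^ 2) ^ 2) =
      h ^ 2 * (3 * s ^ 2 - 1 - 2 * s * h) / ((1 + s ^ 2) ^ 2 * (1 + (s - h) ^ 2)) := by
    field_simp
    ring
  rw [e, abs_div, abs_of_pos (mul_pos (pow_pos h1 2) h2), div_le_iff₀ (mul_pos (pow_pos h1 2) h2)]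
  have e2 : 6 * h ^ 2 * (1 + s ^ 2)⁻¹ * ((1 + s ^ 2) ^ 2 * (1 + (s - h) ^ 2)) =
      h ^ 2 * (6 * (1 + s ^ 2) * (1 + (s - h) ^ 2)) := by
    field_simp
  rw [e2, abs_mul, abs_of_nonneg (sq_nonneg h)]
  refine mul_le_mul_of_nonneg_left ?_ (sq_nonneg h)
  rw [abs_le]
  constructor <;> nlinarith [sq_nonneg (s * (s - h)), sq_nonneg s, sq_nonneg (s - h),
    sq_nonneg (s + (s - h)), sq_nonneg (s - (s - h))]

theorem abs_integral_weight_mul_le {a g : ℝ → ℝ} {K C : ℝ}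
    (hK : ∀ s, |a s| ≤ K * (1 + s ^ 2)⁻¹) (hC : ∀ x, |g x| ≤ C) :
    |∫ s, a s * g s| ≤ K * C * Real.pi := by
  have h : ‖∫ s, a s * g s‖ ≤ ∫ s : ℝ, K * C * (1 + s ^ 2)⁻¹ := by
    refine norm_integral_le_of_norm_le (integrable_inv_one_add_sq.const_mul _)
      (Eventually.of_forall fun s => ?_)
    rw [Real.norm_eq_abs, abs_mul]
    calc |a s| * |g s| ≤ (K * (1 + s ^ 2)⁻¹) * C :=
          mul_le_mul (hK s) (hC s) (abs_nonneg _) ((abs_nonneg _).trans (hK s))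
      _ = K * C * (1 + s ^ 2)⁻¹ := by ring
  rwa [integral_const_mul, integral_univ_inv_one_add_sq, Real.norm_eq_abs] at h

theorem abs_avgSlope_le {g : ℝ → ℝ} {C : ℝ} (hC : ∀ x, |g x| ≤ C) (S : ℝ) :
    |avgSlope g S| ≤ C * Real.pi := by
  have := abs_integral_weight_mul_le (g := fun s => g (S * s)) (K := 1)
    (fun s => (abs_two_mul_div_le s).trans (one_mul _).ge) (fun x => hC _)
  rwa [one_mul] at this

/-- Averaging the correlation `u` of `g` with a function `ρ` of zero mean over translations of
size `S` isolates the first moment of `ρ`. -/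
theorem abs_average_sub_avgSlope_le {g ρ : ℝ → ℝ} (hg : Measurable g) {C : ℝ}
    (hC : ∀ x, |g x| ≤ C) (hρ : Integrable ρ) (hρ1 : Integrable fun x => x * ρ x)
    (hρ2 : Integrable fun x => x ^ 2 * ρ x) (h0 : ∫ x, ρ x = 0) {S : ℝ} (hS : 0 < S) :
    |S * (∫ s, (1 + s ^ 2)⁻¹ * ∫ x, g (x + S * s) * ρ x) - avgSlope g S * ∫ x, x * ρ x| ≤
      6 * C * Real.pi * (∫ x, |x ^ 2 * ρ x|) / S := by
  set N : ℝ → ℝ := fun x => ∫ s, (1 + (s - x / S) ^ 2)⁻¹ * g (S * s) with hN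
  have hgS : Measurable fun s => g (S * s) := hg.comp (measurable_const_mul S)
  -- Fubini and a translation of the weight
  have hprod : Integrable (fun p : ℝ × ℝ => (1 + p.1 ^ 2)⁻¹ * (g (p.2 + S * p.1) * ρ p.2))
      ((volume : Measure ℝ).prod volume) := by
    have hb := (integrable_inv_one_add_sq.mul_prod hρ).bdd_mul (c := C)
      (f := fun p : ℝ × ℝ => g (p.2 + S * p.1))
      (hg.comp (by fun_prop)).aestronglyMeasurable
      (Eventually.of_forall fun p => hC _)
    refine hb.congr (Eventually.of_forall fun p => ?_)
    simp only
    ring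
  have hfub : ∫ s, (1 + s ^ 2)⁻¹ * ∫ x, g (x + S * s) * ρ x = ∫ x, N x * ρ x := by
    simp_rw [← integral_const_mul]
    rw [integral_integral_swap hprod]
    refine integral_congr_ae (Eventually.of_forall fun x => ?_)
    have e := integral_add_right_eq_self (μ := volume)
      (fun s => (1 + (s - x / S) ^ 2)⁻¹ * g (S * s)) (x / S)
    simp only [hN]
    rw [← e, ← integral_mul_const]
    refine integral_congr_ae (Eventually.of_forall fun s => ?_)
    simp only [add_sub_cancel_right]
    rw [mul_add, mul_div_cancel₀ _ hS.ne', add_comm (S * s)]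
    ring
  -- Taylor expansion of `N` at `0`
  have hNint (x : ℝ) : Integrable fun s => (1 + (s - x / S) ^ 2)⁻¹ * g (S * s) := by
    have h := (integrable_inv_one_add_sq.comp_sub_right (x / S)).bdd_mul (c := C)
      hgS.aestronglyMeasurable (Eventually.of_forall fun s => hC _)
    exact h.congr (Eventually.of_forall fun s => mul_comm _ _)
  have hMint : Integrable fun s => 2 * s / (1 + s ^ 2) ^ 2 * g (S * s) :=
    integrable_weight_mul (by fun_prop)
      ⟨1, fun s => (abs_two_mul_div_le s).trans (one_mul _).ge⟩ hgS (fun s => hC _)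
  have hT (x : ℝ) : |N x - N 0 - x / S * avgSlope g S| ≤ 6 * (x / S) ^ 2 * C * Real.pi := by
    have e : N x - N 0 - x / S * avgSlope g S =
        ∫ s, ((1 + (s - x / S) ^ 2)⁻¹ - (1 + s ^ 2)⁻¹ - x / S * (2 * s / (1 + s ^ 2) ^ 2))
          * g (S * s) := by
      have hN0 := hNint 0
      simp only [zero_div, sub_zero] at hN0
      simp only [hN, avgSlope, zero_div, sub_zero]
      have hsub : Integrable fun s =>
          (1 + (s - x / S) ^ 2)⁻¹ * g (S * s) - (1 + s ^ 2)⁻¹ * g (S * s) := (hNint x).sub hN0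
      rw [← integral_const_mul, ← integral_sub (hNint x) hN0,
        ← integral_sub hsub (hMint.const_mul _)]
      refine integral_congr_ae (Eventually.of_forall fun s => ?_)
      simp only
      ring
    rw [e]
    exact abs_integral_weight_mul_le (abs_weight_taylor_le · (x / S)) (fun s => hC _)
  have hNm : AEStronglyMeasurable N := by
    have : StronglyMeasurable (Function.uncurry fun x s : ℝ =>
        (1 + (s - x / S) ^ 2)⁻¹ * g (S * s)) := by
      refine Measurable.stronglyMeasurable (Measurable.mul (by fun_prop) ?_)
      exact hg.comp (by fun_prop)
    exact this.integral_prod_right.aestronglyMeasurable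
  have hNρ : Integrable fun x => N x * ρ x := by
    refine hρ.bdd_mul (c := 1 * C * Real.pi) hNm (Eventually.of_forall fun x => ?_)
    simp only [hN]
    rw [← integral_add_right_eq_self _ (x / S)]
    simp only [add_sub_cancel_right]
    exact abs_integral_weight_mul_le (K := 1)
      (fun s => by rw [one_mul, abs_of_nonneg (by positivity)]) (fun s => hC _)
  have hmain : S * (∫ s, (1 + s ^ 2)⁻¹ * ∫ x, g (x + S * s) * ρ x) -
      avgSlope g S * ∫ x, x * ρ x = ∫ x, S * (N x - N 0 - x / S * avgSlope g S) * ρ x := by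
    have e (x : ℝ) : S * (N x - N 0 - x / S * avgSlope g S) * ρ x =
        S * (N x * ρ x) - S * N 0 * ρ x - avgSlope g S * (x * ρ x) := by
      field_simp
    simp_rw [e]
    have hsub : Integrable fun x => S * (N x * ρ x) - S * N 0 * ρ x :=
      (hNρ.const_mul S).sub (hρ.const_mul _)
    rw [integral_sub hsub (hρ1.const_mul _),
      integral_sub (hNρ.const_mul S) (hρ.const_mul _), integral_const_mul, integral_const_mul,
      integral_const_mul, h0, hfub]
    ring
  rw [hmain]
  have hfin : ‖∫ x, S * (N x - N 0 - x / S * avgSlope g S) * ρ x‖ ≤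
      ∫ x, 6 * C * Real.pi / S * |x ^ 2 * ρ x| := by
    refine norm_integral_le_of_norm_le (hρ2.abs.const_mul _) (Eventually.of_forall fun x => ?_)
    rw [Real.norm_eq_abs, abs_mul, abs_mul, abs_of_pos hS, abs_mul, abs_of_nonneg (sq_nonneg x)]
    calc S * |N x - N 0 - x / S * avgSlope g S| * |ρ x|
        ≤ S * (6 * (x / S) ^ 2 * C * Real.pi) * |ρ x| := by
          have := hT x
          gcongr
      _ = 6 * C * Real.pi / S * (x ^ 2 * |ρ x|) := by field_simp
  rw [integral_const_mul, Real.norm_eq_abs] at hfin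
  refine hfin.trans (le_of_eq ?_)
  ring

/-! ### Monotonicity of the symbols -/

theorem exists_tendsto_ultrafilter {ι E : Type*} [PseudoMetricSpace E] [ProperSpace E]
    (𝒰 : Ultrafilter ι) {a : ι → E} {c : E} {R : ℝ} (h : ∀ᶠ i in (𝒰 : Filter ι), dist (a i) c ≤ R) :
    ∃ L, Tendsto a 𝒰 (𝓝 L) := by
  obtain ⟨L, -, hL⟩ := (isCompact_closedBall c R).ultrafilter_le_nhds (𝒰.map a)
    (by rw [le_principal_iff]; exact h)
  exact ⟨L, hL⟩

/-- If the averages of a nonnegative continuous function against the weights `1 / (1 + (t/n)^2)`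
tend to zero, then the function vanishes at the origin. -/
theorem eq_zero_of_tendsto_average {u : ℝ → ℝ} (hu : Continuous u) (hpos : ∀ t, 0 ≤ u t)
    {C : ℝ} (hC : ∀ t, |u t| ≤ C) {l : Filter ℕ} [l.NeBot]
    (h : Tendsto (fun n : ℕ => ((n : ℝ) + 1) * ∫ s, (1 + s ^ 2)⁻¹ * u (((n : ℝ) + 1) * s)) l (𝓝 0)) :
    u 0 = 0 := by
  by_contra hne
  have h0 : 0 < u 0 := lt_of_le_of_ne (hpos 0) (Ne.symm hne)
  obtain ⟨δ', hδ', hb'⟩ := Metric.eventually_nhds_iff_ball.1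
    ((hu.tendsto 0).eventually (lt_mem_nhds (half_lt_self h0)))
  set δ := min (δ' / 2) 1 with hδdef
  have hδ : 0 < δ := by positivity
  have hb (t : ℝ) (ht : t ∈ Set.Icc 0 δ) : u 0 / 2 ≤ u t := by
    refine (hb' t ?_).le
    rw [Metric.mem_ball, dist_zero_right, Real.norm_eq_abs, abs_of_nonneg ht.1]
    calc t ≤ δ := ht.2
      _ ≤ δ' / 2 := min_le_left _ _
      _ < δ' := half_lt_self hδ'
  have key (n : ℕ) : δ * (u 0 / 4) ≤
      ((n : ℝ) + 1) * ∫ s, (1 + s ^ 2)⁻¹ * u (((n : ℝ) + 1) * s) := by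
    have hS : (0 : ℝ) < (n : ℝ) + 1 := by positivity
    have hint : Integrable fun s : ℝ => (1 + s ^ 2)⁻¹ * u (((n : ℝ) + 1) * s) :=
      integrable_weight_mul (by fun_prop)
        ⟨1, fun s => by rw [one_mul, abs_of_nonneg (by positivity)]⟩
        (g := fun s => u (((n : ℝ) + 1) * s)) (by fun_prop) (fun s => hC _)
    have h1 : ∫ s in Set.Icc 0 (δ / ((n : ℝ) + 1)), u 0 / 4 ≤
        ∫ s in Set.Icc 0 (δ / ((n : ℝ) + 1)), (1 + s ^ 2)⁻¹ * u (((n : ℝ) + 1) * s) := by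
      refine setIntegral_mono_on (by simp) hint.integrableOn measurableSet_Icc fun s hs => ?_
      have hs2 : s * ((n : ℝ) + 1) ≤ δ := (le_div_iff₀ hS).1 hs.2
      have hs3 : s ≤ 1 := by
        have : δ ≤ 1 := min_le_right _ _
        have hn : (0 : ℝ) ≤ n := n.cast_nonneg
        nlinarith [hs.1, mul_nonneg hs.1 hn]
      have hw : (2 : ℝ)⁻¹ ≤ (1 + s ^ 2)⁻¹ := by
        rw [inv_le_inv₀ (by norm_num) (by positivity)]
        nlinarith [hs.1]
      have hu2 : u 0 / 2 ≤ u (((n : ℝ) + 1) * s) :=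
        hb _ ⟨mul_nonneg hS.le hs.1, by rwa [mul_comm]⟩
      calc u 0 / 4 = 2⁻¹ * (u 0 / 2) := by ring
        _ ≤ _ := mul_le_mul hw hu2 (by positivity) (by positivity)
    have h2 := setIntegral_le_integral (s := Set.Icc 0 (δ / ((n : ℝ) + 1))) hint
      (Eventually.of_forall fun s => mul_nonneg (by positivity) (hpos _))
    have h3 := h1.trans h2
    rw [setIntegral_const, Real.volume_real_Icc_of_le (by positivity), sub_zero, smul_eq_mul] at h3
    calc δ * (u 0 / 4) = ((n : ℝ) + 1) * (δ / ((n : ℝ) + 1) * (u 0 / 4)) := by field_simp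
      _ ≤ _ := mul_le_mul_of_nonneg_left h3 hS.le
  have := ge_of_tendsto' h key
  have h4 : 0 < δ * (u 0 / 4) := by positivity
  linarith

/-- If the commutator is positive and nonzero, then `g` increases on average, in one of the two
directions, and the symbol of `f(P)` is monotone in that direction in the weak sense. -/
theorem exists_avgSlope_limit {f g : ℝ → ℝ} (hf : BddMeas f) (hg : BddMeas g)
    (hgm : Measurable g) (hpos : ∀ φ, 0 ≤ form f g hf hg φ) (hne : ∃ φ, form f g hf hg φ ≠ 0) :
    ∃ M : ℝ, M ≠ 0 ∧
      Tendsto (fun n : ℕ => avgSlope g ((n : ℝ) + 1)) (hyperfilter ℕ : Filter ℕ) (𝓝 M) ∧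
      ∀ φ : 𝓢(ℝ, ℂ), 0 ≤ M * ∫ x, x * density f hf (φ.toLp 2 volume) x := by
  obtain ⟨C, hC⟩ := hg.bounded
  obtain ⟨M, hM⟩ := exists_tendsto_ultrafilter (hyperfilter ℕ)
    (a := fun n : ℕ => avgSlope g ((n : ℝ) + 1)) (c := 0) (R := C * Real.pi)
    (Eventually.of_forall fun n => by
      rw [dist_zero_right, Real.norm_eq_abs]; exact abs_avgSlope_le hC _)
  have htop : Tendsto (fun n : ℕ => (n : ℝ) + 1) (hyperfilter ℕ : Filter ℕ) atTop := by
    refine Tendsto.mono_left (tendsto_natCast_atTop_atTop.atTop_add tendsto_const_nhds) ?_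
    rw [← Nat.cofinite_eq_atTop]
    exact hyperfilter_le_cofinite
  have hu (φ : 𝓢(ℝ, ℂ)) (t : ℝ) : form f g hf hg (translate t (φ.toLp 2 volume)) =
      ∫ x, g (x + t) * density f hf (φ.toLp 2 volume) x := form_translate _ _ _ _
  have hlim (φ : 𝓢(ℝ, ℂ)) : Tendsto (fun n : ℕ => ((n : ℝ) + 1) * ∫ s, (1 + s ^ 2)⁻¹ *
      form f g hf hg (translate (((n : ℝ) + 1) * s) (φ.toLp 2 volume))) (hyperfilter ℕ : Filter ℕ)
      (𝓝 (M * ∫ x, x * density f hf (φ.toLp 2 volume) x)) := by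
    have hM' := hM.mul_const (∫ x, x * density f hf (φ.toLp 2 volume) x)
    refine (tendsto_iff_of_dist ?_).2 hM'
    refine squeeze_zero (fun n => dist_nonneg) (fun n => ?_) ((tendsto_const_nhds
      (x := 6 * C * Real.pi * (∫ x, |x ^ 2 * density f hf (φ.toLp 2 volume) x|))).div_atTop htop)
    simp_rw [hu]
    exact abs_average_sub_avgSlope_le hgm hC (integrable_density hf _)
      (integrable_coord_mul_density hf φ) (integrable_coord_sq_mul_density hf φ)
      (integral_density hf _) (by positivity)
  refine ⟨M, ?_, hM, fun φ => ge_of_tendsto' (hlim φ) fun n => ?_⟩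
  · -- if the limit were zero, then positivity would force the form to vanish on Schwartz states
    rintro rfl
    obtain ⟨φ₀, hφ₀⟩ := hne
    refine hφ₀ (dense_schwartz.induction_on (p := fun φ => form f g hf hg φ = 0) φ₀
      (isClosed_eq (continuous_form hf hg) continuous_const) fun φ => ?_)
    have ht0 : translate 0 (φ.toLp 2 volume) = φ.toLp 2 volume := by
      apply Lp.ext
      filter_upwards [coeFn_translate 0 (φ.toLp 2 volume)] with x hx
      rw [hx, sub_zero]
    have := eq_zero_of_tendsto_average
      (u := fun t => form f g hf hg (translate t (φ.toLp 2 volume)))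
      ((continuous_form hf hg).comp (continuous_translate_left _)) (fun t => hpos _)
      (C := ∫ x, C * |density f hf (φ.toLp 2 volume) x|) (fun t => ?_)
      (by simpa only [zero_mul] using hlim φ)
    · simpa only [ht0] using this
    · rw [hu, ← Real.norm_eq_abs]
      refine norm_integral_le_of_norm_le ((integrable_density hf _).abs.const_mul C)
        (Eventually.of_forall fun x => ?_)
      rw [Real.norm_eq_abs, abs_mul]
      exact mul_le_mul_of_nonneg_right (hC _) (abs_nonneg _)
  · refine mul_nonneg (by positivity) (integral_nonneg fun s => mul_nonneg (by positivity) (hpos _))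

/-- The average slope of a nondecreasing function is nonnegative, since its weight is odd. -/
theorem avgSlope_nonneg {g : ℝ → ℝ} (hg : Monotone g) {C : ℝ} (hC : ∀ x, |g x| ≤ C) {S : ℝ}
    (hS : 0 ≤ S) : 0 ≤ avgSlope g S := by
  have hodd : ∫ s : ℝ, 2 * s / (1 + s ^ 2) ^ 2 * g 0 = 0 := by
    have h := integral_neg_eq_self (fun s : ℝ => 2 * s / (1 + s ^ 2) ^ 2 * g 0) volume
    have h' : ∫ s : ℝ, 2 * (-s) / (1 + (-s) ^ 2) ^ 2 * g 0 =
        -∫ s : ℝ, 2 * s / (1 + s ^ 2) ^ 2 * g 0 := by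
      rw [← integral_neg]
      refine integral_congr_ae (Eventually.of_forall fun s => ?_)
      simp only [neg_sq]
      ring
    linarith
  have hi (g : ℝ → ℝ) (hg : Measurable g) (hC : ∀ x, |g x| ≤ C) :
      Integrable fun s => 2 * s / (1 + s ^ 2) ^ 2 * g (S * s) :=
    integrable_weight_mul (g := fun s => g (S * s)) (by fun_prop)
      ⟨1, fun s => (abs_two_mul_div_le s).trans (one_mul _).ge⟩ (by fun_prop) (fun s => hC _)
  rw [avgSlope, ← hodd]
  refine integral_mono (hi (fun _ => g 0) measurable_const fun _ => hC 0) (hi g hg.measurable hC)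
    fun s => ?_
  simp only
  have h : (0 : ℝ) < (1 + s ^ 2) ^ 2 := by positivity
  rw [div_mul_eq_mul_div, div_mul_eq_mul_div, div_le_div_iff_of_pos_right h]
  rcases le_total 0 s with hs | hs
  · exact mul_le_mul_of_nonneg_left (hg (mul_nonneg hS hs)) (by linarith)
  · exact mul_le_mul_of_nonpos_left (hg (mul_nonpos_of_nonneg_of_nonpos hS hs)) (by linarith)

theorem avgSlope_congr {g g' : ℝ → ℝ} (h : g =ᵐ[volume] g') {S : ℝ} (hS : S ≠ 0) :
    avgSlope g S = avgSlope g' S := by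
  refine integral_congr_ae ?_
  filter_upwards [(quasiMeasurePreserving_mul_left hS).ae_eq_comp h] with s hs
  simp only [Function.comp_apply] at hs
  rw [hs]

/-- Every real test function `θ` is the Fourier transform of a Schwartz state, so that first moments
of densities pair the weak derivative of `dilate f` with `θ ^ 2`. -/
theorem integral_bump_test {f : ℝ → ℝ} (hf : BddMeas f) {θ : ℝ → ℝ} (hθ : ContDiff ℝ (⊤ : ℕ∞) θ)
    (hc : HasCompactSupport θ) :
    ∃ φ : 𝓢(ℝ, ℂ), ∫ x, x * density f hf (φ.toLp 2 volume) x =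
      -(1 / Real.pi) * ∫ ξ, dilate f ξ * (deriv θ ξ * θ ξ) := by
  have h1 : HasCompactSupport fun x => (θ x : ℂ) := hc.comp_left Complex.ofReal_zero
  have h2 : ContDiff ℝ (⊤ : ℕ∞) fun x => (θ x : ℂ) := Complex.ofRealCLM.contDiff.comp hθ
  set ψ : 𝓢(ℝ, ℂ) := h1.toSchwartzMap h2
  have hψ (x : ℝ) : ψ x = θ x := rfl
  refine ⟨𝓕⁻ ψ, ?_⟩
  rw [integral_coord_mul_density, FourierTransform.fourier_fourierInv_eq]
  congr 1
  refine integral_congr_ae (Eventually.of_forall fun ξ => ?_)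
  have hd : deriv ψ ξ = ((deriv θ ξ : ℝ) : ℂ) := by
    have : HasDerivAt (fun x => (θ x : ℂ)) ((deriv θ ξ : ℝ) : ℂ) ξ :=
      ((hθ.differentiable (by simp)).differentiableAt.hasDerivAt).ofReal_comp
    exact this.deriv
  simp only [hd, hψ, Complex.conj_ofReal]
  rw [← Complex.ofReal_mul, Complex.ofReal_re]

/-- The derivative of the convolution of `h` with `θ ^ 2` is the pairing of the weak derivative of
`h` with the square of a translated reflection of `θ`. -/
theorem monotone_convolution_sq {h : ℝ → ℝ} (hm : Measurable h) {C : ℝ} (hC : ∀ x, |h x| ≤ C)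
    (H : ∀ θ : ℝ → ℝ, ContDiff ℝ (⊤ : ℕ∞) θ → HasCompactSupport θ →
      ∫ ξ, h ξ * (deriv θ ξ * θ ξ) ≤ 0)
    {θ : ℝ → ℝ} (hθ : ContDiff ℝ (⊤ : ℕ∞) θ) (hc : HasCompactSupport θ) :
    Monotone fun x => ∫ t, h t * θ (x - t) ^ 2 := by
  have hloc : LocallyIntegrable h volume :=
    (memLp_top_of_bound hm.aestronglyMeasurable C (Eventually.of_forall hC)).locallyIntegrable
      le_top
  have hsq : HasCompactSupport fun x => θ x ^ 2 := hc.comp_left (g := fun y => y ^ 2) (by norm_num)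
  have hs : ContDiff ℝ 1 fun x => θ x ^ 2 := (hθ.pow 2).of_le (by norm_num)
  have hd (x : ℝ) : HasDerivAt
      (convolution h (fun x => θ x ^ 2) (ContinuousLinearMap.mul ℝ ℝ) volume)
      (convolution h (deriv fun x => θ x ^ 2) (ContinuousLinearMap.mul ℝ ℝ) volume x) x :=
    hsq.hasDerivAt_convolution_right (ContinuousLinearMap.mul ℝ ℝ) hloc hs x
  have heq : convolution h (fun x => θ x ^ 2) (ContinuousLinearMap.mul ℝ ℝ) volume =
      fun x => ∫ t, h t * θ (x - t) ^ 2 := by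
    funext x
    simp only [convolution_def, ContinuousLinearMap.mul_apply']
  rw [heq] at hd
  refine monotone_of_deriv_nonneg (fun x => (hd x).differentiableAt) fun x => ?_
  rw [(hd x).deriv, convolution_def]
  have hθd (y : ℝ) : HasDerivAt θ (deriv θ y) y :=
    (hθ.differentiable (by simp)).differentiableAt.hasDerivAt
  have hH := H (fun t => θ (x - t)) (hθ.comp (contDiff_const.sub contDiff_id))
    (hc.comp_homeomorph (Homeomorph.subLeft x))
  have e (t : ℝ) : (ContinuousLinearMap.mul ℝ ℝ) (h t) (deriv (fun x => θ x ^ 2) (x - t)) =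
      -2 * (h t * (deriv (fun t => θ (x - t)) t * θ (x - t))) := by
    have e1 : deriv (fun x => θ x ^ 2) (x - t) = 2 * θ (x - t) * deriv θ (x - t) := by
      have := (hθd (x - t)).pow 2
      exact this.deriv.trans (by norm_num)
    have e2 : deriv (fun t => θ (x - t)) t = -deriv θ (x - t) := by
      have := (hθd (x - t)).comp t ((hasDerivAt_id t).const_sub x)
      exact this.deriv.trans (by ring)
    rw [e1, e2, ContinuousLinearMap.mul_apply']
    ring
  simp_rw [e]
  rw [integral_const_mul]
  linarith

/-- A bounded function whose weak derivative is nonnegative on squares of test functions agrees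
almost everywhere with a nondecreasing function. -/
theorem exists_monotone_ae_eq {h : ℝ → ℝ} (hm : Measurable h) {C : ℝ} (hC : ∀ x, |h x| ≤ C)
    (H : ∀ θ : ℝ → ℝ, ContDiff ℝ (⊤ : ℕ∞) θ → HasCompactSupport θ →
      ∫ ξ, h ξ * (deriv θ ξ * θ ξ) ≤ 0) :
    ∃ h₀ : ℝ → ℝ, Monotone h₀ ∧ (∀ x, |h₀ x| ≤ C) ∧ h =ᵐ[volume] h₀ := by
  have hloc : LocallyIntegrable h volume :=
    (memLp_top_of_bound hm.aestronglyMeasurable C (Eventually.of_forall hC)).locallyIntegrable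
      le_top
  have hii (a b : ℝ) : IntervalIntegrable h volume a b :=
    (hloc.integrableOn_isCompact isCompact_uIcc).intervalIntegrable
  set F : ℝ → ℝ := fun x => ∫ t in (0 : ℝ)..x, h t with hF
  have hFc : Continuous F := intervalIntegral.continuous_primitive hii 0
  -- increments of the primitive are nondecreasing, because they are so after mollification by
  -- squares of bumps
  have hD (δ : ℝ) (hδ : 0 ≤ δ) : Monotone fun x => F (x + δ) - F x := by
    set D : ℝ → ℝ := fun x => F (x + δ) - F x with hDdef
    have hDc : Continuous D := by fun_prop
    have hDs (x : ℝ) : D x = ∫ s in Set.Ioc 0 δ, h (x + s) := by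
      rw [hDdef, ← intervalIntegral.integral_of_le hδ]
      simp only [hF]
      rw [intervalIntegral.integral_interval_sub_left (hii _ _) (hii _ _),
        intervalIntegral.integral_comp_add_left, add_zero]
    let b (n : ℕ) : ContDiffBump (0 : ℝ) :=
      ⟨1 / ((n : ℝ) + 1) / 2, 1 / ((n : ℝ) + 1), by positivity, half_lt_self (by positivity)⟩
    have hbs (n : ℕ) : ContDiff ℝ (⊤ : ℕ∞) (b n) := (b n).contDiff
    have hI (n : ℕ) : 0 < ∫ x, b n x ^ 2 := by
      have hcont : Continuous fun x => b n x ^ 2 := (b n).continuous.pow 2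
      refine hcont.integral_pos_of_hasCompactSupport_nonneg_nonzero
        ((b n).hasCompactSupport.comp_left (g := fun y => y ^ 2) (by norm_num))
        (fun x => sq_nonneg _) (x := 0) ?_
      rw [(b n).one_of_mem_closedBall (Metric.mem_closedBall_self (b n).rIn_pos.le)]
      norm_num
    let κ (n : ℕ) (x : ℝ) : ℝ := (∫ x, b n x ^ 2)⁻¹ * b n x ^ 2
    have hlim (x : ℝ) : Tendsto
        (fun n => convolution (κ n) D (ContinuousLinearMap.lsmul ℝ ℝ) volume x) atTop (𝓝 (D x)) := by
      refine convolution_tendsto_right (g := fun _ => D) (k := fun _ => x)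
        (Eventually.of_forall fun n x => ?_) (Eventually.of_forall fun n => ?_) ?_
        (Eventually.of_forall fun n => hDc.aestronglyMeasurable)
        ((hDc.tendsto x).comp tendsto_snd) tendsto_const_nhds
      · exact mul_nonneg (inv_nonneg.2 (hI n).le) (sq_nonneg _)
      · simp only [κ]
        rw [integral_const_mul, inv_mul_cancel₀ (hI n).ne']
      · rw [tendsto_smallSets_iff]
        intro t ht
        obtain ⟨ε, hε, hεt⟩ := Metric.mem_nhds_iff.1 ht
        filter_upwards [(tendsto_one_div_add_atTop_nhds_zero_nat (𝕜 := ℝ)).eventually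
          (gt_mem_nhds hε)] with n hn x hx
        refine hεt ?_
        by_contra hx'
        refine hx ?_
        have : b n x = 0 := by
          refine (b n).zero_of_le_dist (le_trans hn.le ?_)
          simpa [Metric.mem_ball] using hx'
        simp [κ, this]
    have hmono (n : ℕ) :
        Monotone (convolution (κ n) D (ContinuousLinearMap.lsmul ℝ ℝ) volume) := by
      have hκc : Continuous fun x => b n x ^ 2 := (b n).continuous.pow 2
      have hκi : Integrable fun x => b n x ^ 2 := hκc.integrable_of_hasCompactSupport
        ((b n).hasCompactSupport.comp_left (g := fun y => y ^ 2) (by norm_num))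
      have e (x : ℝ) : convolution (κ n) D (ContinuousLinearMap.lsmul ℝ ℝ) volume x =
          (∫ x, b n x ^ 2)⁻¹ * ∫ s in Set.Ioc 0 δ, ∫ t, h t * b n (x + s - t) ^ 2 := by
        have hprod : Integrable (fun p : ℝ × ℝ => b n p.1 ^ 2 * h (x - p.1 + p.2))
            ((volume : Measure ℝ).prod (volume.restrict (Set.Ioc 0 δ))) := by
          have h1 : Integrable (fun p : ℝ × ℝ => b n p.1 ^ 2 * (1 : ℝ))
              ((volume : Measure ℝ).prod (volume.restrict (Set.Ioc 0 δ))) :=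
            hκi.mul_prod (g := fun _ => (1 : ℝ)) (integrable_const 1)
          have h2 := h1.bdd_mul (c := C) (f := fun p : ℝ × ℝ => h (x - p.1 + p.2))
            (hm.comp (by fun_prop)).aestronglyMeasurable (Eventually.of_forall fun p => hC _)
          exact h2.congr (Eventually.of_forall fun p => by simp only; ring)
        rw [convolution_def]
        simp only [κ, ContinuousLinearMap.lsmul_apply, smul_eq_mul, mul_assoc]
        rw [integral_const_mul]
        congr 1
        simp_rw [hDs, ← integral_const_mul]
        rw [integral_integral_swap hprod]
        refine integral_congr_ae (Eventually.of_forall fun s => ?_)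
        simp only
        rw [← integral_sub_left_eq_self (fun t => h t * b n (x + s - t) ^ 2) volume (x + s)]
        refine integral_congr_ae (Eventually.of_forall fun t => ?_)
        simp only [sub_sub_cancel]
        rw [mul_comm]
        congr 2
        ring
      intro x y hxy
      rw [e, e]
      have hJ := monotone_convolution_sq hm hC H (hbs n) (b n).hasCompactSupport
      refine mul_le_mul_of_nonneg_left ?_ (inv_nonneg.2 (hI n).le)
      have hJi (x : ℝ) : IntegrableOn (fun s => ∫ t, h t * b n (x + s - t) ^ 2) (Set.Ioc 0 δ) :=
        ((show Monotone fun s => ∫ t, h t * b n (x + s - t) ^ 2 from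
          fun s s' hs => hJ (by linarith)).intervalIntegrable (a := 0) (b := δ)).1
      exact setIntegral_mono_on (hJi x) (hJi y) measurableSet_Ioc fun s _ => hJ (by linarith)
    intro x y hxy
    exact le_of_tendsto_of_tendsto' (hlim x) (hlim y) fun n => hmono n hxy
  -- Lebesgue differentiation
  have hae : ∀ᵐ x, HasDerivAt F (h x) x := by
    filter_upwards [_root_.LocallyIntegrable.ae_hasDerivAt_integral hloc] with x hx
    exact hx 0
  set E : Set ℝ := {x | HasDerivAt F (h x) x} with hE
  have hEm : MonotoneOn h E := by
    intro x hx y hy hxy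
    have hslope (z : ℝ) (hz : z ∈ E) :
        Tendsto (fun δ => δ⁻¹ • (F (z + δ) - F z)) (𝓝[>] 0) (𝓝 (h z)) :=
      (hasDerivAt_iff_tendsto_slope_zero.1 hz).mono_left
        (nhdsWithin_mono 0 fun δ hδ => ne_of_gt hδ)
    refine le_of_tendsto_of_tendsto (hslope x hx) (hslope y hy) ?_
    filter_upwards [self_mem_nhdsWithin] with δ hδ
    exact smul_le_smul_of_nonneg_left (hD δ (le_of_lt hδ) hxy) (inv_nonneg.2 (le_of_lt hδ))
  obtain ⟨k, hk, hke⟩ := hEm.exists_monotone_extension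
    ⟨-C, by rintro _ ⟨x, -, rfl⟩; exact (abs_le.1 (hC x)).1⟩
    ⟨C, by rintro _ ⟨x, -, rfl⟩; exact (abs_le.1 (hC x)).2⟩
  have hC0 : 0 ≤ C := (abs_nonneg _).trans (hC 0)
  refine ⟨fun x => max (-C) (min C (k x)), ?_, fun x => ?_, ?_⟩
  · exact fun x y hxy => max_le_max_left _ (min_le_min_left _ (hk hxy))
  · exact abs_le.2 ⟨le_max_left _ _, max_le (by linarith) (min_le_left _ _)⟩
  · filter_upwards [hae] with x hx
    rw [← hke hx, min_eq_right (abs_le.1 (hC x)).2, max_eq_right (abs_le.1 (hC x)).1]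

/-- A bounded measurable function agrees almost everywhere with a bounded Borel function. -/
theorem BddMeas.exists_measurable {f : ℝ → ℝ} (hf : BddMeas f) :
    ∃ f' : ℝ → ℝ, Measurable f' ∧ BddMeas f' ∧ f =ᵐ[volume] f' := by
  obtain ⟨C, hC⟩ := hf.bounded
  have hC0 : 0 ≤ C := (abs_nonneg _).trans (hC 0)
  have hmeas : Measurable fun x => max (-C) (min C (hf.aemeasurable.mk f x)) :=
    measurable_const.max (measurable_const.min hf.aemeasurable.measurable_mk)
  refine ⟨_, hmeas, ⟨hmeas.aemeasurable, C, fun x => ?_⟩, ?_⟩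
  · exact abs_le.2 ⟨le_max_left _ _, max_le (by linarith) (min_le_left _ _)⟩
  · filter_upwards [hf.aemeasurable.ae_eq_mk] with x hx
    rw [← hx, min_eq_right (abs_le.1 (hC x)).2, max_eq_right (abs_le.1 (hC x)).1]

theorem exists_monotone_of_dilate {f f₁ : ℝ → ℝ} (h : dilate f =ᵐ[volume] f₁) (hf₁ : Monotone f₁)
    {C : ℝ} (hC : ∀ x, |f₁ x| ≤ C) :
    ∃ f₀ : ℝ → ℝ, Monotone f₀ ∧ (∀ x, |f₀ x| ≤ C) ∧ f =ᵐ[volume] f₀ := by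
  have hpi := Real.two_pi_pos
  refine ⟨fun x => f₁ ((2 * Real.pi)⁻¹ * x), fun x y hxy => hf₁ (by gcongr), fun x => hC _, ?_⟩
  have := (quasiMeasurePreserving_mul_left (inv_ne_zero hpi.ne')).ae_eq_comp h
  filter_upwards [this] with x hx
  simp only [Function.comp_apply, dilate] at hx
  rw [← hx, mul_inv_cancel_left₀ hpi.ne']

/-- If the commutator is positive and nonzero, then `f` is nondecreasing up to a null set if `g`
increases on average, and nonincreasing if `g` decreases on average; no third case is possible. -/
theorem exists_monotone_of_form_nonneg {f g : ℝ → ℝ} (hf : BddMeas f) (hg : BddMeas g)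
    (hpos : ∀ φ, 0 ≤ form f g hf hg φ) (hne : ∃ φ, form f g hf hg φ ≠ 0) :
    ∃ M : ℝ, Tendsto (fun n : ℕ => avgSlope g ((n : ℝ) + 1)) (hyperfilter ℕ : Filter ℕ) (𝓝 M) ∧
      ((0 < M ∧ ∃ f₀ : ℝ → ℝ, Monotone f₀ ∧ (∃ C, ∀ x, |f₀ x| ≤ C) ∧ f =ᵐ[volume] f₀) ∨
        (M < 0 ∧ ∃ f₀ : ℝ → ℝ, Monotone f₀ ∧ (∃ C, ∀ x, |f₀ x| ≤ C) ∧
          (fun x => -f x) =ᵐ[volume] f₀)) := by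
  obtain ⟨f', hfm, hf', hff'⟩ := hf.exists_measurable
  obtain ⟨g', hgm, hg', hgg'⟩ := hg.exists_measurable
  have hform := form_congr hf hg hf' hg' hff' hgg'
  obtain ⟨M, hM0, hM, hMφ⟩ := exists_avgSlope_limit hf' hg' hgm (fun φ => hform φ ▸ hpos φ)
    (hne.imp fun φ h => hform φ ▸ h)
  have hM' : Tendsto (fun n : ℕ => avgSlope g ((n : ℝ) + 1)) (hyperfilter ℕ : Filter ℕ) (𝓝 M) := by
    refine hM.congr fun n => (avgSlope_congr hgg' (by positivity)).symm
  have hdm : Measurable (dilate f') := hfm.comp (measurable_const_mul _)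
  obtain ⟨C, hC⟩ := hf'.dilate.bounded
  have htest (θ : ℝ → ℝ) (hθ : ContDiff ℝ (⊤ : ℕ∞) θ) (hc : HasCompactSupport θ) :
      M * ∫ ξ, dilate f' ξ * (deriv θ ξ * θ ξ) ≤ 0 := by
    obtain ⟨φ, hφ⟩ := integral_bump_test hf' hθ hc
    have h := hMφ φ
    rw [hφ] at h
    have hpi := Real.pi_pos
    have h2 : 0 ≤ (1 / Real.pi) * -(M * ∫ ξ, dilate f' ξ * (deriv θ ξ * θ ξ)) := by linarith
    have := nonneg_of_mul_nonneg_right h2 (by positivity)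
    linarith
  refine ⟨M, hM', ?_⟩
  rcases lt_or_gt_of_ne hM0 with hneg | hpos'
  · right
    obtain ⟨h₀, hm, hb, he⟩ := exists_monotone_ae_eq (h := fun x => -dilate f' x) hdm.neg (C := C)
      (fun x => by rw [abs_neg]; exact hC x) (fun θ hθ hc => by
        have := nonneg_of_mul_nonpos_right (htest θ hθ hc) hneg
        simp only [neg_mul]
        rw [integral_neg]
        linarith)
    have he' : dilate (fun x => -f x) =ᵐ[volume] h₀ :=
      (dilate_congr (hff'.neg)).trans he
    obtain ⟨f₀, h1, h2, h3⟩ := exists_monotone_of_dilate he' hm hb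
    exact ⟨hneg, f₀, h1, ⟨C, h2⟩, h3⟩
  · left
    obtain ⟨h₀, hm, hb, he⟩ := exists_monotone_ae_eq hdm hC (fun θ hθ hc =>
      nonpos_of_mul_nonpos_right (htest θ hθ hc) hpos')
    obtain ⟨f₀, h1, h2, h3⟩ := exists_monotone_of_dilate ((dilate_congr hff').trans he) hm hb
    exact ⟨hpos', f₀, h1, ⟨C, h2⟩, h3⟩

/-- If `f` is nondecreasing, then so is `g` up to a null set. After the exchange of position and
momentum, `f` takes the place of the second symbol, and its average slope has a sign. -/
theorem exists_monotone_right_of_left {f g f₀ : ℝ → ℝ} (hf : BddMeas f) (hg : BddMeas g)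
    (hpos : ∀ φ, 0 ≤ form f g hf hg φ) (hne : ∃ φ, form f g hf hg φ ≠ 0)
    (hf₀ : Monotone f₀) (hb : ∃ C, ∀ x, |f₀ x| ≤ C) (hff₀ : f =ᵐ[volume] f₀) :
    ∃ g₀ : ℝ → ℝ, Monotone g₀ ∧ (∃ C, ∀ x, |g₀ x| ≤ C) ∧ g =ᵐ[volume] g₀ := by
  have hpos' (ψ : L2R) : 0 ≤ form (reflect g) (dilate f) hg.reflect hf.dilate ψ := by
    have := hpos (fourierL2.symm ψ)
    rwa [form_swap, LinearIsometryEquiv.apply_symm_apply] at this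
  obtain ⟨φ, hφ⟩ := hne
  obtain ⟨M, hM, h⟩ := exists_monotone_of_form_nonneg hg.reflect hf.dilate hpos'
    ⟨_, by rwa [← form_swap hf hg]⟩
  obtain ⟨C, hC⟩ := hb
  have hmono : Monotone (dilate f₀) := fun x y hxy =>
    hf₀ (mul_le_mul_of_nonneg_left hxy Real.two_pi_pos.le)
  have hM0 : 0 ≤ M := ge_of_tendsto' hM fun n => by
    rw [avgSlope_congr (dilate_congr hff₀) (by positivity)]
    exact avgSlope_nonneg hmono (fun x => hC _) (by positivity)
  rcases h with ⟨-, k, hk, ⟨D, hD⟩, he⟩ | ⟨hlt, -⟩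
  · refine ⟨fun x => -k (-(2 * Real.pi) * x), fun x y hxy => ?_, ⟨D, fun x => ?_⟩, ?_⟩
    · have hpi := Real.two_pi_pos
      exact neg_le_neg (hk (by nlinarith))
    · rw [abs_neg]
      exact hD _
    · filter_upwards [(quasiMeasurePreserving_mul_left
        (neg_ne_zero.2 Real.two_pi_pos.ne')).ae_eq_comp he] with x hx
      simp only [Function.comp_apply, reflect] at hx
      rw [← hx, neg_neg, ← mul_assoc, neg_mul_neg, inv_mul_cancel₀ Real.two_pi_pos.ne', one_mul]
  · exact absurd hM0 (not_le.2 hlt)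

/-- If the commutator is positive and nonzero, then up to null sets `f` and `g` are both
nondecreasing, or both nonincreasing. -/
theorem exists_monotone_pair {f g : ℝ → ℝ} (hf : BddMeas f) (hg : BddMeas g)
    (hpos : ∀ φ, 0 ≤ form f g hf hg φ) (hne : ∃ φ, form f g hf hg φ ≠ 0) :
    ∃ f₀ g₀ : ℝ → ℝ, Monotone f₀ ∧ Monotone g₀ ∧ (∃ C, ∀ x, |f₀ x| ≤ C) ∧ (∃ C, ∀ x, |g₀ x| ≤ C) ∧
      ((f =ᵐ[volume] f₀ ∧ g =ᵐ[volume] g₀) ∨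
        ((fun x => -f x) =ᵐ[volume] f₀ ∧ (fun x => -g x) =ᵐ[volume] g₀)) := by
  obtain ⟨-, -, ⟨-, f₀, h1, h2, h3⟩ | ⟨-, f₀, h1, h2, h3⟩⟩ :=
    exists_monotone_of_form_nonneg hf hg hpos hne
  · obtain ⟨g₀, k1, k2, k3⟩ := exists_monotone_right_of_left hf hg hpos hne h1 h2 h3
    exact ⟨f₀, g₀, h1, k1, h2, k2, Or.inl ⟨h3, k3⟩⟩
  · obtain ⟨g₀, k1, k2, k3⟩ := exists_monotone_right_of_left hf.neg hg.neg
      (fun φ => by rw [form_neg_neg]; exact hpos φ)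
      (hne.imp fun φ h => by rwa [form_neg_neg]) h1 h2 h3
    exact ⟨f₀, g₀, h1, k1, h2, k2, Or.inr ⟨h3, k3⟩⟩

/-! ### Mollification -/

/-- The average of the translates of `f` with respect to the measure `μ`, i.e. the convolution
of `f` with `μ`. -/
def mollify (f : ℝ → ℝ) (μ : Measure ℝ) : ℝ → ℝ := fun x => ∫ y, f (x - y) ∂μ

theorem abs_mollify_le {f : ℝ → ℝ} {C : ℝ} (hC : ∀ x, |f x| ≤ C) (μ : Measure ℝ)
    [IsProbabilityMeasure μ] (x : ℝ) : |mollify f μ x| ≤ C := by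
  have := norm_integral_le_of_norm_le_const (μ := μ) (f := fun y => f (x - y))
    (Eventually.of_forall fun y => hC _)
  simpa [mollify] using this

theorem measurable_mollify {f : ℝ → ℝ} (hf : Measurable f) (μ : Measure ℝ) [SFinite μ] :
    Measurable (mollify f μ) := by
  have : StronglyMeasurable (Function.uncurry fun x y : ℝ => f (x - y)) :=
    (hf.comp (by fun_prop)).stronglyMeasurable
  exact this.integral_prod_right.measurable

theorem bddMeas_mollify {f : ℝ → ℝ} (hf : Measurable f) {C : ℝ} (hC : ∀ x, |f x| ≤ C)
    (μ : Measure ℝ) [IsProbabilityMeasure μ] : BddMeas (mollify f μ) :=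
  ⟨(measurable_mollify hf μ).aemeasurable, C, abs_mollify_le hC μ⟩

theorem integrable_translate {f : ℝ → ℝ} (hf : Measurable f) {C : ℝ} (hC : ∀ x, |f x| ≤ C)
    (μ : Measure ℝ) [IsProbabilityMeasure μ] (x : ℝ) : Integrable (fun y => f (x - y)) μ :=
  Integrable.of_bound (hf.comp (by fun_prop)).aestronglyMeasurable C
    (Eventually.of_forall fun y => hC _)

theorem monotone_mollify {f : ℝ → ℝ} (hf : Monotone f) {C : ℝ} (hC : ∀ x, |f x| ≤ C)
    (μ : Measure ℝ) [IsProbabilityMeasure μ] : Monotone (mollify f μ) := fun x y hxy =>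
  integral_mono (integrable_translate hf.measurable hC μ x)
    (integrable_translate hf.measurable hC μ y) fun z => hf (by linarith)

/-- Averaging `g` over translations averages the form over translated states. -/
theorem form_mollify_right_nonneg {f g : ℝ → ℝ} (hf : BddMeas f) (hg : BddMeas g)
    (hgm : Measurable g) (μ : Measure ℝ) [IsProbabilityMeasure μ]
    (hgμ : BddMeas (mollify g μ)) (hpos : ∀ φ, 0 ≤ form f g hf hg φ) (φ : L2R) :
    0 ≤ form f (mollify g μ) hf hgμ φ := by
  obtain ⟨C, hC⟩ := hg.bounded
  have hprod : Integrable (fun p : ℝ × ℝ => g (p.1 - p.2) * density f hf φ p.1)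
      ((volume : Measure ℝ).prod μ) := by
    have h1 := (integrable_density hf φ).mul_prod (ν := μ) (g := fun _ => (1 : ℝ))
      (integrable_const 1)
    have h2 := h1.bdd_mul (c := C) (f := fun p : ℝ × ℝ => g (p.1 - p.2))
      (hgm.comp (by fun_prop)).aestronglyMeasurable (Eventually.of_forall fun p => hC _)
    exact h2.congr (Eventually.of_forall fun p => by simp only [mul_one])
  rw [form_eq_integral]
  simp only [mollify]
  simp_rw [← integral_mul_const]
  rw [integral_integral_swap hprod]
  refine integral_nonneg fun y => ?_
  have := hpos (translate (-y) φ)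
  rw [form_translate] at this
  rw [Pi.zero_apply]
  simpa only [← sub_eq_add_neg] using this

theorem dilate_mollify (f : ℝ → ℝ) (hf : Measurable f) (μ : Measure ℝ) :
    dilate (mollify f μ) = mollify (dilate f) (μ.map fun y => (2 * Real.pi)⁻¹ * y) := by
  have hpi := Real.two_pi_pos
  funext x
  simp only [dilate, mollify]
  have hm : Measurable fun y => f (2 * Real.pi * (x - y)) := hf.comp (by fun_prop)
  rw [integral_map (by fun_prop) hm.aestronglyMeasurable]
  simp only [mul_sub, mul_inv_cancel_left₀ hpi.ne']

/-- Both symbols can be mollified independently, without losing positivity. -/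
theorem form_mollify_nonneg {f g : ℝ → ℝ} (hf : BddMeas f) (hg : BddMeas g)
    (hfm : Measurable f) (hgm : Measurable g) (μ ν : Measure ℝ) [IsProbabilityMeasure μ]
    [IsProbabilityMeasure ν] (hfμ : BddMeas (mollify f μ)) (hgν : BddMeas (mollify g ν))
    (hpos : ∀ φ, 0 ≤ form f g hf hg φ) (φ : L2R) :
    0 ≤ form (mollify f μ) (mollify g ν) hfμ hgν φ := by
  have h1 := form_mollify_right_nonneg hf hg hgm ν hgν hpos
  have h2 (ψ : L2R) : 0 ≤ form (reflect (mollify g ν)) (dilate f) hgν.reflect hf.dilate ψ := by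
    have := h1 (fourierL2.symm ψ)
    rwa [form_swap, LinearIsometryEquiv.apply_symm_apply] at this
  have : IsProbabilityMeasure (μ.map fun y => (2 * Real.pi)⁻¹ * y) :=
    Measure.isProbabilityMeasure_map (by fun_prop)
  have hd := dilate_mollify f hfm μ
  have h3 := form_mollify_right_nonneg hgν.reflect hf.dilate (hfm.comp (measurable_const_mul _))
    (μ.map fun y => (2 * Real.pi)⁻¹ * y) (hd ▸ hfμ.dilate) h2 (fourierL2 φ)
  rw [form_swap]
  simpa only [hd] using h3

theorem tendsto_mollify_map {f : ℝ → ℝ} (hf : Measurable f) {C : ℝ} (hC : ∀ x, |f x| ≤ C)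
    (μ : Measure ℝ) [IsProbabilityMeasure μ] {ε : ℕ → ℝ} (hε : Tendsto ε atTop (𝓝 0)) {x : ℝ}
    (hx : ContinuousAt f x) :
    Tendsto (fun n => mollify f (μ.map fun y => ε n * y) x) atTop (𝓝 (f x)) := by
  have e (n : ℕ) : mollify f (μ.map fun y => ε n * y) x = ∫ y, f (x - ε n * y) ∂μ :=
    integral_map (by fun_prop) (hf.comp (by fun_prop)).aestronglyMeasurable
  simp_rw [e]
  have h := tendsto_integral_of_dominated_convergence (μ := μ) (fun _ => C)
    (F := fun n y => f (x - ε n * y)) (f := fun _ => f x)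
    (fun n => (hf.comp (by fun_prop)).aestronglyMeasurable) (integrable_const C)
    (fun n => Eventually.of_forall fun y => hC _)
    (Eventually.of_forall fun y => by
      have h1 : Tendsto (fun n => x - ε n * y) atTop (𝓝 x) := by
        simpa using tendsto_const_nhds.sub (hε.mul_const y)
      exact hx.tendsto.comp h1)
  simpa using h

theorem tendsto_opQ {g : ℝ → ℝ} (hg : BddMeas g) {G : ℕ → ℝ → ℝ} (hG : ∀ n, BddMeas (G n))
    {C : ℝ} (hC : ∀ n x, |G n x| ≤ C) (h : ∀ᵐ x, Tendsto (fun n => G n x) atTop (𝓝 (g x)))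
    (φ : L2R) : Tendsto (fun n => opQ (G n) (hG n) φ) atTop (𝓝 (opQ g hg φ)) := by
  obtain ⟨D, hD⟩ := hg.bounded
  have hC0 : 0 ≤ C := (abs_nonneg _).trans (hC 0 0)
  have hD0 : 0 ≤ D := (abs_nonneg _).trans (hD 0)
  have hnorm (ψ : L2R) : ‖ψ‖ ^ 2 = ∫ x, ‖ψ x‖ ^ 2 := by
    have h1 := inner_self_eq_norm_sq_to_K (𝕜 := ℂ) ψ
    rw [L2.inner_def] at h1
    simp_rw [inner_self_eq_norm_sq_to_K] at h1
    have h2 : ((∫ x, ‖ψ x‖ ^ 2 : ℝ) : ℂ) = ((‖ψ‖ ^ 2 : ℝ) : ℂ) := by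
      rw [← integral_complex_ofReal]
      push_cast
      exact_mod_cast h1
    exact_mod_cast h2.symm
  rw [tendsto_iff_norm_sub_tendsto_zero]
  have hsq : Tendsto (fun n => ‖opQ (G n) (hG n) φ - opQ g hg φ‖ ^ 2) atTop (𝓝 0) := by
    simp_rw [hnorm]
    have hlim := tendsto_integral_of_dominated_convergence (μ := (volume : Measure ℝ))
      (F := fun n x => ‖(opQ (G n) (hG n) φ - opQ g hg φ : L2R) x‖ ^ 2) (f := fun _ => (0 : ℝ))
      (fun x => (C + D) ^ 2 * ‖φ x‖ ^ 2)
      (fun n => (Lp.aestronglyMeasurable _).norm.pow 2)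
      ((((Lp.memLp φ).integrable_norm_pow (by norm_num))).const_mul _) (fun n => ?_) ?_
    · simpa using hlim
    · filter_upwards [Lp.coeFn_sub (opQ (G n) (hG n) φ) (opQ g hg φ), coeFn_opQ (G n) (hG n) φ,
        coeFn_opQ g hg φ] with x h1 h2 h3
      rw [h1, Pi.sub_apply, h2, h3, ← sub_mul, norm_mul, Real.norm_eq_abs,
        abs_of_nonneg (by positivity), mul_pow]
      gcongr
      rw [← Complex.ofReal_sub, Complex.norm_real, Real.norm_eq_abs]
      exact (abs_sub _ _).trans (add_le_add (hC n x) (hD x))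
    · have hall : ∀ᵐ x, ∀ n, (opQ (G n) (hG n) φ - opQ g hg φ : L2R) x =
          ((G n x : ℂ) - g x) * φ x := by
        rw [ae_all_iff]
        intro n
        filter_upwards [Lp.coeFn_sub (opQ (G n) (hG n) φ) (opQ g hg φ), coeFn_opQ (G n) (hG n) φ,
          coeFn_opQ g hg φ] with x h1 h2 h3
        rw [h1, Pi.sub_apply, h2, h3, ← sub_mul]
      filter_upwards [hall, h] with x hx hx'
      simp_rw [hx]
      have h1 : Tendsto (fun n => ((G n x : ℂ) - g x) * φ x) atTop (𝓝 (((g x : ℂ) - g x) * φ x)) :=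
        (((Complex.continuous_ofReal.tendsto _).comp hx').sub_const _).mul_const _
      simpa using h1.norm.pow 2
  have := (Real.continuous_sqrt.tendsto 0).comp hsq
  simpa [Function.comp_def, Real.sqrt_sq (norm_nonneg _)] using this

theorem tendsto_form {f g : ℝ → ℝ} (hf : BddMeas f) (hg : BddMeas g) {F G : ℕ → ℝ → ℝ}
    (hF : ∀ n, BddMeas (F n)) (hG : ∀ n, BddMeas (G n)) {C D : ℝ} (hC : ∀ n x, |F n x| ≤ C)
    (hD : ∀ n x, |G n x| ≤ D) (h : ∀ᵐ x, Tendsto (fun n => F n x) atTop (𝓝 (f x)))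
    (h' : ∀ᵐ x, Tendsto (fun n => G n x) atTop (𝓝 (g x))) (φ : L2R) :
    Tendsto (fun n => form (F n) (G n) (hF n) (hG n) φ) atTop (𝓝 (form f g hf hg φ)) := by
  have h1 := tendsto_opQ hg hG hD h' φ
  have h2 := tendsto_opQ hf.dilate (fun n => (hF n).dilate) (fun n x => hC n _)
    ((quasiMeasurePreserving_mul_left Real.two_pi_pos.ne').ae h) (fourierL2 φ)
  have h3 : Tendsto (fun n => opP (F n) (hF n) φ) atTop (𝓝 (opP f hf φ)) :=
    (fourierL2.symm.continuous.tendsto _).comp h2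
  exact ((Complex.continuous_im.tendsto _).comp (h1.inner h3)).const_mul 2

end

/-! ### The Gauss–Cauchy mollifier -/

/-- The convolution of a bounded function with a holomorphic kernel having locally uniform
integrable bounds along horizontal lines is holomorphic. -/
theorem differentiableOn_integral_kernel {H : ℝ → ℝ} (hH : Measurable H) {C : ℝ}
    (hC : ∀ x, |H x| ≤ C) {k : ℂ → ℂ} (hk : Measurable k) {V : Set ℂ} (hV : IsOpen V)
    (hkV : DifferentiableOn ℂ k V) (hVt : ∀ z ∈ V, ∀ u : ℝ, z - u ∈ V)
    (hB : ∀ z₀ ∈ V, ∃ r > 0, ∃ B : ℝ → ℝ, Integrable B ∧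
      ∀ z, dist z z₀ ≤ r → z ∈ V ∧ ∀ u : ℝ, ‖k (z - u)‖ ≤ B u) :
    DifferentiableOn ℂ (fun z => ∫ u : ℝ, (H u : ℂ) * k (z - u)) V := by
  intro z₀ hz₀
  obtain ⟨r, hr, B, hBi, hBb⟩ := hB z₀ hz₀
  have hC0 : 0 ≤ C := (abs_nonneg _).trans (hC 0)
  have hsub (z : ℂ) : Measurable fun u : ℝ => z - (u : ℂ) := by fun_prop
  have hHm : Measurable fun u => (H u : ℂ) := Complex.measurable_ofReal.comp hH
  have hmem {z : ℂ} (hz : z ∈ Metric.ball z₀ (r / 2)) {w : ℂ} (hw : dist w z ≤ r / 2) :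
      dist w z₀ ≤ r := by
    have := dist_triangle w z z₀
    have := Metric.mem_ball.1 hz
    linarith
  have hd (z : ℂ) (hz : z ∈ Metric.ball z₀ (r / 2)) (u : ℝ) :
      HasDerivAt (fun z => (H u : ℂ) * k (z - u)) ((H u : ℂ) * deriv k (z - u)) z := by
    have hzV : z ∈ V := (hBb z (hmem hz (by rw [dist_self]; positivity))).1
    have h1 : HasDerivAt k (deriv k (z - u)) (z - u) :=
      (hkV.differentiableAt (hV.mem_nhds (hVt z hzV u))).hasDerivAt
    have h2 : HasDerivAt (fun z => k (z - u)) (deriv k (z - u)) z := by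
      have := h1.comp z ((hasDerivAt_id z).sub_const (u : ℂ))
      rwa [mul_one] at this
    exact h2.const_mul _
  have hb (z : ℂ) (hz : z ∈ Metric.ball z₀ (r / 2)) (u : ℝ) :
      ‖(H u : ℂ) * deriv k (z - u)‖ ≤ C * (B u / (r / 2)) := by
    rw [norm_mul, Complex.norm_real]
    refine mul_le_mul (hC u) ?_ (norm_nonneg _) hC0
    have hin (w : ℂ) (hw : dist w (z - u) ≤ r / 2) : w ∈ V ∧ ‖k w‖ ≤ B u := by
      have h1 : dist (w + u) z ≤ r / 2 := by
        rwa [dist_eq_norm, show w + u - z = w - (z - u) by ring, ← dist_eq_norm]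
      have h2 := hBb _ (hmem hz h1)
      have h3 := hVt _ h2.1 u
      have h4 := h2.2 u
      rw [add_sub_cancel_right] at h3 h4
      exact ⟨h3, h4⟩
    refine Complex.norm_deriv_le_of_forall_mem_sphere_norm_le (half_pos hr) ?_
      fun w hw => (hin w (Metric.mem_sphere.1 hw).le).2
    refine DifferentiableOn.diffContOnCl (hkV.mono fun w hw => ?_)
    rw [closure_ball _ (half_pos hr).ne'] at hw
    exact (hin w hw).1
  have hF0 : Integrable fun u : ℝ => (H u : ℂ) * k (z₀ - u) := by
    refine Integrable.mono' (hBi.const_mul C)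
      (hHm.mul (hk.comp (hsub z₀))).aestronglyMeasurable (Eventually.of_forall fun u => ?_)
    rw [norm_mul, Complex.norm_real]
    exact mul_le_mul (hC u) ((hBb z₀ (by simp [hr.le])).2 u) (norm_nonneg _) hC0
  exact ((hasDerivAt_integral_of_dominated_loc_of_deriv_le
    (Metric.ball_mem_nhds z₀ (half_pos hr))
    (Eventually.of_forall fun z => (hHm.mul (hk.comp (hsub z))).aestronglyMeasurable) hF0
    (F' := fun z u => (H u : ℂ) * deriv k (z - u))
    (hHm.mul ((measurable_deriv k).comp (hsub z₀))).aestronglyMeasurable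
    (Eventually.of_forall fun u z hz => hb z hz u) ((hBi.div_const _).const_mul C)
    (Eventually.of_forall fun u z hz => hd z hz u)).2.differentiableAt).differentiableWithinAt

/-- Convolutions with a Gaussian are entire. -/
theorem isEntire_mollify_gaussian {H : ℝ → ℝ} (hH : Measurable H) {C : ℝ}
    (hC : ∀ x, |H x| ≤ C) : IsEntire (mollify H (ProbabilityTheory.gaussianReal 0 1)) := by
  let c : ℝ := (√(2 * Real.pi))⁻¹
  let k : ℂ → ℂ := fun z => c * Complex.exp (-z ^ 2 / 2)
  have hkd : Differentiable ℂ k := by fun_prop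
  have hknorm (z : ℂ) : ‖k z‖ = |c| * Real.exp (-(z.re ^ 2 - z.im ^ 2) / 2) := by
    simp only [k]
    rw [norm_mul, Complex.norm_real, Complex.norm_exp, Real.norm_eq_abs]
    congr 2
    rw [show -z ^ 2 / 2 = ((2⁻¹ : ℝ) : ℂ) * -z ^ 2 by push_cast; ring, Complex.re_ofReal_mul]
    simp [sq]
    ring
  refine ⟨fun z => ∫ u : ℝ, (H u : ℂ) * k (z - u), ?_, fun x => ?_⟩
  · rw [← differentiableOn_univ]
    refine differentiableOn_integral_kernel hH hC hkd.continuous.measurable isOpen_univ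
      hkd.differentiableOn (fun _ _ _ => Set.mem_univ _) fun z₀ _ => ⟨1, one_pos,
        fun u => |c| * Real.exp (((|z₀.im| + 1) ^ 2 + 1) / 2) * Real.exp (-(1 / 4) * (u - z₀.re) ^ 2),
        ?_, fun z hz => ⟨Set.mem_univ _, fun u => ?_⟩⟩
    · exact ((integrable_exp_neg_mul_sq (by norm_num : (0 : ℝ) < 1 / 4)).comp_sub_right
        z₀.re).const_mul _
    · simp only
      rw [hknorm, mul_assoc, ← Real.exp_add]
      refine mul_le_mul_of_nonneg_left (Real.exp_le_exp.2 ?_) (abs_nonneg _)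
      have h1 : |z.re - z₀.re| ≤ 1 := (Complex.abs_re_le_norm (z - z₀)).trans
        (by rwa [← dist_eq_norm])
      have h2 : |z.im - z₀.im| ≤ 1 := (Complex.abs_im_le_norm (z - z₀)).trans
        (by rwa [← dist_eq_norm])
      have h3 : |z.im| ≤ |z₀.im| + 1 := by
        have := abs_add_le (z.im - z₀.im) z₀.im
        rw [sub_add_cancel] at this
        linarith
      have h4 : z.im ^ 2 ≤ (|z₀.im| + 1) ^ 2 := by
        rw [← sq_abs]
        gcongr
      have h5 : (z.re - z₀.re) ^ 2 ≤ 1 := by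
        rw [← sq_abs]
        nlinarith [abs_nonneg (z.re - z₀.re)]
      simp only [Complex.sub_re, Complex.sub_im, Complex.ofReal_re, Complex.ofReal_im, sub_zero]
      nlinarith [sq_nonneg ((z.re - u) + (z.re - z₀.re))]
  · have e : mollify H (ProbabilityTheory.gaussianReal 0 1) x =
        ∫ u, c * Real.exp (-(x - u) ^ 2 / 2) * H u := by
      simp only [mollify]
      rw [ProbabilityTheory.integral_gaussianReal_eq_integral_smul one_ne_zero,
        ← integral_sub_left_eq_self _ volume x]
      refine integral_congr_ae (Eventually.of_forall fun u => ?_)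
      simp [ProbabilityTheory.gaussianPDFReal, c]
    rw [e, ← integral_complex_ofReal]
    refine integral_congr_ae (Eventually.of_forall fun u => ?_)
    simp only [k]
    push_cast
    ring

theorem integral_cauchyMeasure (f : ℝ → ℝ) :
    ∫ x, f x ∂(ProbabilityTheory.cauchyMeasure 0 1) =
      ∫ x, Real.pi⁻¹ * (1 + x ^ 2)⁻¹ * f x := by
  rw [ProbabilityTheory.cauchyMeasure_of_scale_ne_zero 0 one_ne_zero,
    integral_withDensity_eq_integral_toReal_smul (ProbabilityTheory.measurable_cauchyPDF _ _)
      (Eventually.of_forall fun x => ENNReal.ofReal_lt_top)]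
  refine integral_congr_ae (Eventually.of_forall fun x => ?_)
  simp only [ProbabilityTheory.cauchyPDF, ProbabilityTheory.cauchyPDFReal]
  rw [ENNReal.toReal_ofReal (by positivity)]
  simp
  left
  ring

/-- A lower bound for `|1 + w²|` inside the strip `|Im w| < 1`. -/
theorem sq_add_sq_le_norm_one_add_sq {w : ℂ} {η : ℝ} (hη : 0 ≤ η) (h : |w.im| + η ≤ 1) :
    w.re ^ 2 + η ^ 2 ≤ ‖1 + w ^ 2‖ := by
  have hy := abs_le.1 (show |w.im| ≤ 1 - η by linarith)
  refine le_of_sq_le_sq ?_ (norm_nonneg _)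
  rw [← Complex.normSq_eq_norm_sq, Complex.normSq_apply]
  simp only [sq, Complex.add_re, Complex.add_im, Complex.mul_re, Complex.mul_im, Complex.one_re,
    Complex.one_im]
  have h1 : η ^ 2 ≤ (1 + w.im) ^ 2 := by nlinarith
  have h2 : η ^ 2 ≤ (1 - w.im) ^ 2 := by nlinarith
  have h3 : (w.re ^ 2 + η ^ 2) * (w.re ^ 2 + η ^ 2) ≤
      (w.re ^ 2 + (1 + w.im) ^ 2) * (w.re ^ 2 + (1 - w.im) ^ 2) := by gcongr
  nlinarith

/-- Convolving a monotone function with the Cauchy distribution produces a function of the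
class `K_1`. The positivity is that of `(m u - m x) (u - x)`: the imaginary part of the Cauchy kernel
at `z - u` is an odd function of `u - Re z`, with the sign of `(u - Re z) Im z`. -/
theorem inK_mollify_cauchy {m : ℝ → ℝ} (hm : Monotone m) {C : ℝ} (hC : ∀ x, |m x| ≤ C) :
    InK 1 (mollify m (ProbabilityTheory.cauchyMeasure 0 1)) := by
  let k : ℂ → ℂ := fun z => (Real.pi : ℂ)⁻¹ * (1 + z ^ 2)⁻¹
  have hkm : Measurable k := by fun_prop
  have hne {w : ℂ} (hw : |w.im| < 1) : 1 + w ^ 2 ≠ 0 := by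
    have := sq_add_sq_le_norm_one_add_sq (w := w) (η := 1 - |w.im|) (by linarith) (by linarith)
    refine norm_pos_iff.1 (lt_of_lt_of_le ?_ this)
    have : 0 < 1 - |w.im| := by linarith
    positivity
  have hbound (z₀ : ℂ) (hz₀ : z₀ ∈ {z : ℂ | |z.im| < 1}) : ∃ r > 0, ∃ B : ℝ → ℝ, Integrable B ∧
      ∀ z, dist z z₀ ≤ r → z ∈ {z : ℂ | |z.im| < 1} ∧ ∀ u : ℝ, ‖k (z - u)‖ ≤ B u := by
    set η : ℝ := (1 - |z₀.im|) / 2 with hη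
    have hz₀' : |z₀.im| < 1 := hz₀
    have hη0 : 0 < η := by linarith
    have hη1 : η ≤ 1 := by linarith [abs_nonneg z₀.im]
    refine ⟨η, hη0, fun u => Real.pi⁻¹ * ((2 + 3 / η ^ 2) * (1 + (u - z₀.re) ^ 2)⁻¹), ?_,
      fun z hz => ?_⟩
    · exact ((integrable_inv_one_add_sq.comp_sub_right z₀.re).const_mul _).const_mul _
    · have h1 : |z.re - z₀.re| ≤ η := (Complex.abs_re_le_norm (z - z₀)).trans
        (by rwa [← dist_eq_norm])
      have h2 : |z.im - z₀.im| ≤ η := (Complex.abs_im_le_norm (z - z₀)).trans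
        (by rwa [← dist_eq_norm])
      have h3 : |z.im| + η ≤ 1 := by
        have := abs_add_le (z.im - z₀.im) z₀.im
        rw [sub_add_cancel] at this
        linarith
      refine ⟨lt_of_lt_of_le (lt_add_of_pos_right _ hη0) h3, fun u => ?_⟩
      have h4 := sq_add_sq_le_norm_one_add_sq (w := z - u) hη0.le (by simpa using h3)
      have h5 : (z.re - z₀.re) ^ 2 ≤ 1 := by
        rw [← sq_abs]
        nlinarith [abs_nonneg (z.re - z₀.re)]
      simp only [Complex.sub_re, Complex.ofReal_re] at h4
      have hpos : 0 < (z.re - u) ^ 2 + η ^ 2 := by positivity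
      simp only [k]
      rw [norm_mul, norm_inv, norm_inv, Complex.norm_real, Real.norm_eq_abs,
        abs_of_pos Real.pi_pos]
      refine mul_le_mul_of_nonneg_left ?_ (by positivity)
      rw [← div_eq_mul_inv, le_div_iff₀ (by positivity), inv_mul_le_iff₀ (hpos.trans_le h4)]
      have h6 : 1 + (u - z₀.re) ^ 2 ≤ ((z.re - u) ^ 2 + η ^ 2) * (2 + 3 / η ^ 2) := by
        have e : ((z.re - u) ^ 2 + η ^ 2) * (2 + 3 / η ^ 2) =
            2 * (z.re - u) ^ 2 + 3 * (z.re - u) ^ 2 / η ^ 2 + 2 * η ^ 2 + 3 := by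
          field_simp
          ring
        have h7 : 0 ≤ 3 * (z.re - u) ^ 2 / η ^ 2 := by positivity
        rw [e]
        nlinarith [sq_nonneg ((z.re - u) + (z.re - z₀.re)), sq_nonneg η]
      exact h6.trans (mul_le_mul_of_nonneg_right h4 (by positivity))
  have hopen : IsOpen {z : ℂ | |z.im| < 1} :=
    isOpen_lt (by fun_prop) continuous_const
  refine ⟨⟨C, abs_mollify_le hC _⟩, fun z => ∫ u : ℝ, (m u : ℂ) * k (z - u), ?_, fun x => ?_,
    fun z hz => ?_⟩
  · refine differentiableOn_integral_kernel hm.measurable hC hkm hopen ?_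
      (fun z hz u => by simpa using hz) hbound
    intro z hz
    have hp : DifferentiableAt ℂ (fun z : ℂ => 1 + z ^ 2) z := by fun_prop
    exact ((hp.inv (hne hz)).const_mul _).differentiableWithinAt
  · simp only [mollify]
    rw [integral_cauchyMeasure, ← integral_sub_left_eq_self _ volume x, ← integral_complex_ofReal]
    refine integral_congr_ae (Eventually.of_forall fun u => ?_)
    simp only [k]
    push_cast
    ring
  · -- integrability of the kernel along the line through `z`
    have hkint (m : ℝ → ℝ) (hm : Measurable m) (hC : ∀ x, |m x| ≤ C) :
        Integrable fun u : ℝ => (m u : ℂ) * k (z - u) := by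
      obtain ⟨r, hr, B, hBi, hB⟩ := hbound z hz
      have hms : Measurable fun u : ℝ => z - (u : ℂ) := by fun_prop
      refine Integrable.mono' (hBi.const_mul C)
        ((Complex.measurable_ofReal.comp hm).mul (hkm.comp hms)).aestronglyMeasurable
        (Eventually.of_forall fun u => ?_)
      rw [norm_mul, Complex.norm_real]
      exact mul_le_mul (hC u) ((hB z (by simp [hr.le])).2 u) (norm_nonneg _)
        ((abs_nonneg _).trans (hC u))
    have him (m : ℝ → ℝ) (hm : Measurable m) (hC : ∀ x, |m x| ≤ C) :
        (∫ u : ℝ, (m u : ℂ) * k (z - u)).im = ∫ u : ℝ, m u * (k (z - u)).im := by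
      have := integral_im (hkint m hm hC)
      simp only [RCLike.im_to_complex, Complex.im_ofReal_mul] at this
      exact this.symm
    have hkim (w : ℂ) : (k w).im = Real.pi⁻¹ * (-(2 * w.re * w.im) / Complex.normSq (1 + w ^ 2)) := by
      simp only [k]
      rw [← Complex.ofReal_inv, Complex.im_ofReal_mul, Complex.inv_im]
      simp [sq]
      ring
    have hodd : ∫ u : ℝ, m z.re * (k (z - u)).im = 0 := by
      rw [integral_const_mul]
      have h1 : ∫ u : ℝ, (k (z - u)).im = ∫ u : ℝ, (k (u + z.im * Complex.I)).im := by
        rw [← integral_sub_left_eq_self _ volume z.re]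
        refine integral_congr_ae (Eventually.of_forall fun u => ?_)
        simp only
        congr 2
        apply Complex.ext <;> simp
      have h2 : ∫ u : ℝ, (k (u + z.im * Complex.I)).im = -∫ u : ℝ, (k (u + z.im * Complex.I)).im := by
        conv_lhs => rw [← integral_neg_eq_self]
        rw [← integral_neg]
        refine integral_congr_ae (Eventually.of_forall fun u => ?_)
        simp only
        rw [hkim, hkim, Complex.normSq_apply, Complex.normSq_apply]
        simp [sq]
        ring
      rw [h1, show ∫ u : ℝ, (k (u + z.im * Complex.I)).im = 0 by linarith, mul_zero]
    have hint (m : ℝ → ℝ) (hm : Measurable m) (hC : ∀ x, |m x| ≤ C) :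
        Integrable fun u : ℝ => m u * (k (z - u)).im := by
      have := (hkint m hm hC).im
      simpa only [RCLike.im_to_complex, Complex.im_ofReal_mul] using this
    have hfin : (∫ u : ℝ, (m u : ℂ) * k (z - u)).im * z.im =
        ∫ u : ℝ, (m u - m z.re) * ((k (z - u)).im * z.im) := by
      rw [him m hm.measurable hC, ← sub_zero (∫ u : ℝ, m u * (k (z - u)).im), ← hodd,
        ← integral_sub (hint m hm.measurable hC) (hint (fun _ => m z.re) measurable_const
          fun _ => hC _), ← integral_mul_const]
      refine integral_congr_ae (Eventually.of_forall fun u => ?_)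
      simp only
      ring
    rw [hfin]
    refine integral_nonneg fun u => ?_
    rw [Pi.zero_apply, hkim]
    have e : (m u - m z.re) * (Real.pi⁻¹ * (-(2 * (z - u).re * (z - u).im) /
        Complex.normSq (1 + (z - u) ^ 2)) * z.im) =
        ((m u - m z.re) * (u - z.re)) * (2 * z.im ^ 2 * (Real.pi⁻¹ *
          (Complex.normSq (1 + (z - u) ^ 2))⁻¹)) := by
      simp only [Complex.sub_re, Complex.sub_im, Complex.ofReal_re, Complex.ofReal_im, sub_zero]
      ring
    rw [e]
    have h1 : 0 ≤ (m u - m z.re) * (u - z.re) := by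
      rcases le_total u z.re with h | h
      · exact mul_nonneg_of_nonpos_of_nonpos (sub_nonpos.2 (hm h)) (sub_nonpos.2 h)
      · exact mul_nonneg (sub_nonneg.2 (hm h)) (sub_nonneg.2 h)
    have h2 := Complex.normSq_nonneg (1 + (z - u) ^ 2)
    have h3 := Real.pi_pos
    positivity

theorem mollify_conv {f : ℝ → ℝ} (hf : Measurable f) {C : ℝ} (hC : ∀ x, |f x| ≤ C)
    (μ ν : Measure ℝ) [IsProbabilityMeasure μ] [IsProbabilityMeasure ν] :
    mollify f (μ ∗ ν) = mollify (mollify f ν) μ := by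
  funext x
  simp only [mollify]
  rw [integral_conv (integrable_translate hf hC _ x)]
  simp only [sub_sub]

/-- The law of the sum of independent standard Gaussian and Cauchy variables. -/
def gaussCauchy : Measure ℝ :=
  ProbabilityTheory.gaussianReal 0 1 ∗ ProbabilityTheory.cauchyMeasure 0 1

instance : IsProbabilityMeasure gaussCauchy := by
  unfold gaussCauchy
  infer_instance

theorem isEntire_mollify {f : ℝ → ℝ} (hf : Measurable f) {C : ℝ} (hC : ∀ x, |f x| ≤ C) :
    IsEntire (mollify f gaussCauchy) := by
  rw [gaussCauchy, mollify_conv hf hC]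
  exact isEntire_mollify_gaussian (measurable_mollify hf _) (abs_mollify_le hC _)

theorem inK_mollify {f : ℝ → ℝ} (hf : Monotone f) {C : ℝ} (hC : ∀ x, |f x| ≤ C) :
    InK 1 (mollify f gaussCauchy) := by
  rw [gaussCauchy, Measure.conv_comm, mollify_conv hf.measurable hC]
  exact inK_mollify_cauchy (monotone_mollify hf hC _) (abs_mollify_le hC _)

theorem InK.comp_mul {a : ℝ} {f : ℝ → ℝ} (hf : InK a f) {c : ℝ} (hc : 0 < c) :
    InK (a / c) fun x => f (c * x) := by
  obtain ⟨⟨C, hC⟩, F, hF, hFf, hFp⟩ := hf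
  have him (z : ℂ) : ((c : ℂ) * z).im = c * z.im := Complex.im_ofReal_mul c z
  have hmem {z : ℂ} (hz : |z.im| < a / c) : |((c : ℂ) * z).im| < a := by
    rw [him, abs_mul, abs_of_pos hc, mul_comm]
    exact (lt_div_iff₀ hc).1 hz
  refine ⟨⟨C, fun x => hC _⟩, fun z => F (c * z), ?_, fun x => ?_, fun z hz => ?_⟩
  · exact hF.comp (by fun_prop) fun z hz => hmem hz
  · rw [← hFf]
    push_cast
    rfl
  · have := hFp _ (hmem hz)
    rw [him] at this
    refine nonneg_of_mul_nonneg_right (b := (F (c * z)).im * z.im) (a := c) ?_ hc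
    linarith

theorem IsEntire.comp_mul {f : ℝ → ℝ} (hf : IsEntire f) (c : ℝ) :
    IsEntire fun x => f (c * x) := by
  obtain ⟨F, hF, hFf⟩ := hf
  refine ⟨fun z => F (c * z), by fun_prop, fun x => ?_⟩
  rw [← hFf]
  push_cast
  rfl

/-- The mollifier at scale `ε`. -/
def mollifier (ε : ℝ) : Measure ℝ := gaussCauchy.map fun y => ε * y

instance (ε : ℝ) : IsProbabilityMeasure (mollifier ε) :=
  Measure.isProbabilityMeasure_map (by fun_prop)

theorem mollify_mollifier {f : ℝ → ℝ} (hf : Measurable f) {ε : ℝ} (hε : ε ≠ 0) :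
    mollify f (mollifier ε) = fun x => mollify (fun y => f (ε * y)) gaussCauchy (ε⁻¹ * x) := by
  funext x
  have hm : Measurable fun y => f (x - y) := hf.comp (by fun_prop)
  simp only [mollify, mollifier]
  rw [integral_map (by fun_prop) hm.aestronglyMeasurable]
  simp only [mul_sub, mul_inv_cancel_left₀ hε]

theorem isEntire_mollifier {f : ℝ → ℝ} (hf : Measurable f) {C : ℝ} (hC : ∀ x, |f x| ≤ C)
    {ε : ℝ} (hε : 0 < ε) : IsEntire (mollify f (mollifier ε)) := by
  rw [mollify_mollifier hf hε.ne']
  exact (isEntire_mollify (hf.comp (measurable_const_mul ε)) fun x => hC _).comp_mul ε⁻¹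

theorem exists_inK_mollifier {f : ℝ → ℝ} (hf : Monotone f) {C : ℝ} (hC : ∀ x, |f x| ≤ C)
    {ε : ℝ} (hε : 0 < ε) : ∃ a, 0 < a ∧ InK a (mollify f (mollifier ε)) := by
  rw [mollify_mollifier hf.measurable hε.ne']
  have hmono : Monotone fun y => f (ε * y) := fun x y hxy => hf (by gcongr)
  exact ⟨1 / ε⁻¹, by positivity, (inK_mollify hmono fun x => hC _).comp_mul (inv_pos.2 hε)⟩

/-! ### Limits in the classes `K_a` -/

theorem isOpen_strip (a : ℝ) : IsOpen {z : ℂ | |z.im| < a} :=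
  isOpen_lt (by fun_prop) continuous_const

/-- If a holomorphic function maps the upper and lower halves of a disc centred on the real axis
into the respective half planes, then `(r² - w²) (F (x₀ + w) - F x₀) / w` has nonnegative real part
on the disc. By the maximum principle it is enough to look at the circle `|w| = r`, where
`(r² - w²) / w = conj w - w = -2i Im w`. -/
theorem re_mul_dslope_nonneg {a : ℝ} {F : ℂ → ℂ} (hF : DifferentiableOn ℂ F {z : ℂ | |z.im| < a})
    (hpos : ∀ z : ℂ, |z.im| < a → 0 ≤ (F z).im * z.im) {x₀ : ℝ} (hreal : (F x₀).im = 0)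
    {r : ℝ} (hr : 0 < r) (hra : r < a) {w : ℂ} (hw : ‖w‖ ≤ r) :
    DifferentiableOn ℂ (fun w : ℂ => ((r : ℂ) ^ 2 - w ^ 2) * dslope (fun w => F (x₀ + w)) 0 w)
      (Metric.ball 0 a) ∧
    0 ≤ (((r : ℂ) ^ 2 - w ^ 2) * dslope (fun w => F (x₀ + w)) 0 w).re := by
  have hstrip {w : ℂ} (hw : w ∈ Metric.ball (0 : ℂ) a) : |((x₀ : ℂ) + w).im| < a := by
    rw [mem_ball_zero_iff] at hw
    simpa using (Complex.abs_im_le_norm w).trans_lt hw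
  have hG : DifferentiableOn ℂ (fun w => F (x₀ + w)) (Metric.ball 0 a) :=
    hF.comp (by fun_prop) fun w hw => hstrip hw
  have hd : DifferentiableOn ℂ (dslope (fun w => F (x₀ + w)) 0) (Metric.ball 0 a) :=
    (Complex.differentiableOn_dslope (Metric.ball_mem_nhds 0 (hr.trans hra))).2 hG
  have hp : DifferentiableOn ℂ
      (fun w : ℂ => ((r : ℂ) ^ 2 - w ^ 2) * dslope (fun w => F (x₀ + w)) 0 w)
      (Metric.ball 0 a) :=
    DifferentiableOn.mul (by fun_prop) hd
  refine ⟨hp, ?_⟩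
  have hsub : Metric.closedBall (0 : ℂ) r ⊆ Metric.ball 0 a := Metric.closedBall_subset_ball hra
  have hexp := Complex.norm_le_of_forall_mem_frontier_norm_le (C := 1)
    (f := fun w : ℂ => Complex.exp (-(((r : ℂ) ^ 2 - w ^ 2) *
      dslope (fun w => F (x₀ + w)) 0 w))) (Metric.isBounded_ball (x := (0 : ℂ)) (r := r))
    (DifferentiableOn.diffContOnCl (by
      rw [closure_ball _ hr.ne']
      exact (hp.mono hsub).neg.cexp)) (fun w hw => ?_) (z := w)
    (by rw [closure_ball _ hr.ne', mem_closedBall_zero_iff]; exact hw)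
  · rw [Complex.norm_exp, Real.exp_le_one_iff, Complex.neg_re] at hexp
    linarith
  · rw [frontier_ball _ hr.ne', mem_sphere_zero_iff_norm] at hw
    rw [Complex.norm_exp, Real.exp_le_one_iff, Complex.neg_re, neg_nonpos]
    have hw0 : w ≠ 0 := by
      rintro rfl
      rw [norm_zero] at hw
      exact hr.ne hw
    have hconj : (r : ℂ) ^ 2 = w * conj w := by
      rw [Complex.mul_conj, Complex.normSq_eq_norm_sq, hw]
      push_cast
      rfl
    rw [dslope_of_ne _ hw0, slope_def_field, sub_zero, hconj,
      show (w * conj w - w ^ 2) * ((F (x₀ + w) - F (x₀ + 0)) / w) =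
        (conj w - w) * (F (x₀ + w) - F (x₀ + 0)) by field_simp]
    have h1 := hpos (x₀ + w) (hstrip (hsub (by rw [mem_closedBall_zero_iff, hw])))
    simp only [Complex.add_im, Complex.ofReal_im, zero_add] at h1
    simp only [add_zero, Complex.mul_re, Complex.sub_re, Complex.sub_im, Complex.conj_re,
      Complex.conj_im, hreal]
    linarith

theorem dslope_const_add_zero {F : ℂ → ℂ} {z D : ℂ} (hD : HasDerivAt F D z) :
    dslope (fun w => F (z + w)) 0 0 = D := by
  have h1 : HasDerivAt F D (z + 0) := by rwa [add_zero]
  have h2 := h1.comp (0 : ℂ) ((hasDerivAt_id (0 : ℂ)).const_add z)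
  rw [mul_one] at h2
  rw [dslope_same]
  exact h2.deriv

theorem nonneg_of_hasDerivAt {a : ℝ} (ha : 0 < a) {F : ℂ → ℂ}
    (hF : DifferentiableOn ℂ F {z : ℂ | |z.im| < a})
    (hpos : ∀ z : ℂ, |z.im| < a → 0 ≤ (F z).im * z.im) {x₀ D : ℝ} (hreal : (F x₀).im = 0)
    (hD : HasDerivAt F (D : ℂ) x₀) : 0 ≤ D := by
  have h := (re_mul_dslope_nonneg hF hpos hreal (half_pos ha) (half_lt_self ha) (w := 0)
    (by simpa using (half_pos ha).le)).2
  rw [dslope_const_add_zero hD, zero_pow two_ne_zero, sub_zero, ← Complex.ofReal_pow,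
    ← Complex.ofReal_mul, Complex.ofReal_re] at h
  exact nonneg_of_mul_nonneg_right h (by positivity)

/-- Harnack-type estimate: a function of the class `K_a` is controlled near a real point by its
derivative there. This is the Borel–Carathéodory inequality, applied to the function of
nonnegative real part in `re_mul_dslope_nonneg`. -/
theorem norm_mul_slope_sub_le {a : ℝ} {F : ℂ → ℂ}
    (hF : DifferentiableOn ℂ F {z : ℂ | |z.im| < a})
    (hpos : ∀ z : ℂ, |z.im| < a → 0 ≤ (F z).im * z.im) {x₀ D : ℝ} (hreal : (F x₀).im = 0)
    (hD : HasDerivAt F (D : ℂ) x₀) {r : ℝ} (hr : 0 < r) (hra : r < a) {w : ℂ} (hw : ‖w‖ < r)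
    (hw0 : w ≠ 0) {M : ℝ} (hM : 0 < M) (hMD : r ^ 2 * D ≤ M) :
    ‖((r : ℂ) ^ 2 - w ^ 2) * ((F (x₀ + w) - F x₀) / w) - (r : ℂ) ^ 2 * D‖ ≤
      2 * M * ‖w‖ / (r - ‖w‖) := by
  set p : ℂ → ℂ := fun w => ((r : ℂ) ^ 2 - w ^ 2) * dslope (fun w => F (x₀ + w)) 0 w with hp
  have hpd : DifferentiableOn ℂ p (Metric.ball 0 a) :=
    (re_mul_dslope_nonneg hF hpos hreal hr hra (w := 0) (by simpa using hr.le)).1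
  have hpre {w : ℂ} (hw : ‖w‖ ≤ r) : 0 ≤ (p w).re :=
    (re_mul_dslope_nonneg hF hpos hreal hr hra hw).2
  have hp0 : p 0 = (r : ℂ) ^ 2 * D := by
    simp only [hp, dslope_const_add_zero hD]
    ring
  have hp0re : (p 0).re = r ^ 2 * D := by
    rw [hp0, ← Complex.ofReal_pow, ← Complex.ofReal_mul, Complex.ofReal_re]
  have hbc := Complex.borelCaratheodory (f := fun w => p 0 - p w) (M := M) (R := r) (z := w) hM
    ((differentiableOn_const _).sub (hpd.mono (Metric.ball_subset_ball hra.le)))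
    (fun z hz => by
      have := hpre (mem_ball_zero_iff.1 hz).le
      simp only [Set.mem_ofPred_eq, Complex.sub_re, hp0re]
      linarith) hr (mem_ball_zero_iff.2 hw)
  simp only [sub_self, norm_zero, zero_mul, zero_div, add_zero] at hbc
  have hpw : p w = ((r : ℂ) ^ 2 - w ^ 2) * ((F (x₀ + w) - F x₀) / w) := by
    simp only [hp]
    rw [dslope_of_ne _ hw0, slope_def_field, sub_zero, add_zero]
  rw [← hpw, ← hp0, norm_sub_rev]
  exact hbc

theorem hasDerivAt_of_real {a : ℝ} {F : ℂ → ℂ} {f : ℝ → ℝ}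
    (hF : DifferentiableOn ℂ F {z : ℂ | |z.im| < a}) (ha : 0 < a)
    (hFf : ∀ x : ℝ, F (x : ℂ) = (f x : ℂ)) (x : ℝ) :
    HasDerivAt f (deriv f x) x ∧ HasDerivAt F (deriv f x : ℝ) (x : ℂ) := by
  have hd : HasDerivAt F (deriv F x) x :=
    (hF.differentiableAt ((isOpen_strip a).mem_nhds (by simpa using ha))).hasDerivAt
  have h1 : HasDerivAt f (deriv F x).re x := by
    have := hd.real_of_complex
    simpa only [hFf, Complex.ofReal_re] using this
  have h2 : deriv F x = ((deriv F x).re : ℂ) := by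
    have h3 : HasDerivAt (fun y : ℝ => (f y : ℂ)) (deriv F x) x := by
      have := hd.comp_ofReal
      simpa only [hFf] using this
    exact h3.unique h1.ofReal_comp
  rw [h1.deriv, ← h2]
  exact ⟨h1, hd⟩

/-- Functions of the class `K_a` with a common bound on the real axis are locally uniformly bounded
in the strip. By the mean value theorem there are real points where the derivative is controlled by
the bound, and the Harnack-type estimate applies there. -/
theorem exists_local_bound {a : ℝ} {z₀ : ℂ} (hz₀ : |z₀.im| < a) (C : ℝ) :
    ∃ δ > 0, ∃ B : ℝ, ∀ (f : ℝ → ℝ) (F : ℂ → ℂ), (∀ x, |f x| ≤ C) →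
      DifferentiableOn ℂ F {z : ℂ | |z.im| < a} → (∀ x : ℝ, F (x : ℂ) = (f x : ℂ)) →
      (∀ z : ℂ, |z.im| < a → 0 ≤ (F z).im * z.im) →
      ∀ z ∈ Metric.ball z₀ δ, |z.im| < a ∧ ‖F z‖ ≤ B := by
  have ha : 0 < a := (abs_nonneg _).trans_lt hz₀
  set η : ℝ := (a - |z₀.im|) / 4 with hη
  have hη0 : 0 < η := by linarith
  have hηa : 4 * η ≤ a := by linarith [abs_nonneg z₀.im]
  set D₀ : ℝ := 2 * C / η with hD₀
  refine ⟨η, hη0, C + 2 / η * (a ^ 2 * D₀ + 2 * (a ^ 2 * D₀ + 1) * a / (η / 2)),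
    fun f F hC hF hFf hpos z hz => ?_⟩
  have hC0 : 0 ≤ C := (abs_nonneg _).trans (hC 0)
  have hD₀0 : 0 ≤ D₀ := by positivity
  rw [mem_ball_iff_norm] at hz
  have hre := ((Complex.abs_re_le_norm (z - z₀)).trans_lt hz)
  have him := ((Complex.abs_im_le_norm (z - z₀)).trans_lt hz)
  rw [Complex.sub_re, abs_lt] at hre
  have him' : |z.im| ≤ |z₀.im| + η := by
    have := abs_add_le (z - z₀).im z₀.im
    rw [Complex.sub_im, sub_add_cancel] at this
    rw [Complex.sub_im] at him
    linarith
  refine ⟨by linarith, ?_⟩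
  have hder := hasDerivAt_of_real hF ha hFf
  obtain ⟨ξ, ⟨hξ1, hξ2⟩, hξ⟩ := exists_hasDerivAt_eq_slope f (deriv f)
    (show z₀.re < z₀.re + η by linarith)
    (fun x _ => (hder x).1.continuousAt.continuousWithinAt) (fun x _ => (hder x).1)
  have hDle : deriv f ξ ≤ D₀ := by
    rw [hξ, add_sub_cancel_left, hD₀]
    have h1 := (abs_le.1 (hC (z₀.re + η))).2
    have h2 := (abs_le.1 (hC z₀.re)).1
    gcongr
    linarith
  have hFξ : ‖F ξ‖ ≤ C := by
    rw [hFf, Complex.norm_real]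
    exact hC ξ
  -- the disc of radius `a - η / 2` about `ξ` contains `z` with room to spare, as `|z - ξ| ≤ a - η`
  set w : ℂ := z - ξ with hw
  have hzw : z = ξ + w := by rw [hw]; ring
  rcases eq_or_ne w 0 with hw0 | hw0
  · rw [hzw, hw0, add_zero]
    refine hFξ.trans (le_add_of_nonneg_right (by positivity))
  set r : ℝ := a - η / 2 with hr
  have hr0 : 0 < r := by linarith
  have hwr : ‖w‖ ≤ a - η := by
    refine (Complex.norm_le_abs_re_add_abs_im w).trans ?_
    have h1 : |w.re| ≤ 2 * η := by
      simp only [hw, Complex.sub_re, Complex.ofReal_re]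
      rw [abs_le]
      constructor <;> linarith
    have h2 : w.im = z.im := by simp [hw]
    rw [h2]
    linarith
  have hrw : η / 2 ≤ r - ‖w‖ := by linarith
  have hwn := norm_nonneg w
  have hra : r ^ 2 ≤ a ^ 2 := by
    have : r ≤ a := by linarith
    gcongr
  have hDnn : 0 ≤ deriv f ξ :=
    nonneg_of_hasDerivAt ha hF hpos (by rw [hFf, Complex.ofReal_im]) (hder ξ).2
  have hmain := norm_mul_slope_sub_le hF hpos
    (by rw [hFf, Complex.ofReal_im]) (hder ξ).2 hr0 (by linarith) (w := w) (by linarith) hw0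
    (M := a ^ 2 * D₀ + 1) (by positivity)
    ((mul_le_mul hra hDle hDnn (by positivity)).trans (by linarith))
  set P : ℝ := a ^ 2 * D₀ + 2 * (a ^ 2 * D₀ + 1) * a / (η / 2) with hP
  have hPbound : ‖((r : ℂ) ^ 2 - w ^ 2) * ((F (ξ + w) - F ξ) / w)‖ ≤ P := by
    have h1 : ‖(r : ℂ) ^ 2 * (deriv f ξ : ℝ)‖ ≤ a ^ 2 * D₀ := by
      rw [← Complex.ofReal_pow, ← Complex.ofReal_mul, Complex.norm_real, Real.norm_eq_abs,
        abs_of_nonneg (by positivity)]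
      exact mul_le_mul hra hDle hDnn (by positivity)
    have h2 : 2 * (a ^ 2 * D₀ + 1) * ‖w‖ / (r - ‖w‖) ≤ 2 * (a ^ 2 * D₀ + 1) * a / (η / 2) := by
      have : ‖w‖ ≤ a := by linarith
      gcongr
    have h3 := norm_add_le (((r : ℂ) ^ 2 - w ^ 2) * ((F (ξ + w) - F ξ) / w) -
      (r : ℂ) ^ 2 * (deriv f ξ : ℝ)) ((r : ℂ) ^ 2 * (deriv f ξ : ℝ))
    rw [sub_add_cancel] at h3
    linarith
  have hlow : η / 2 * ‖w‖ ≤ ‖(r : ℂ) ^ 2 - w ^ 2‖ := by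
    have h1 := norm_sub_norm_le ((r : ℂ) ^ 2) (w ^ 2)
    rw [norm_pow, norm_pow, Complex.norm_real, Real.norm_eq_abs, abs_of_pos hr0] at h1
    nlinarith
  have hdiff : ‖F (ξ + w) - F ξ‖ ≤ 2 / η * P := by
    have hw1 : 0 < ‖w‖ := norm_pos_iff.2 hw0
    rw [norm_mul, norm_div] at hPbound
    have h1 : η / 2 * ‖w‖ * (‖F (ξ + w) - F ξ‖ / ‖w‖) ≤ P :=
      (mul_le_mul_of_nonneg_right hlow (by positivity)).trans hPbound
    have h2 : η / 2 * ‖w‖ * (‖F (ξ + w) - F ξ‖ / ‖w‖) = η / 2 * ‖F (ξ + w) - F ξ‖ := by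
      field_simp
    rw [h2] at h1
    calc ‖F (ξ + w) - F ξ‖ = 2 / η * (η / 2 * ‖F (ξ + w) - F ξ‖) := by field_simp
      _ ≤ 2 / η * P := by gcongr
  have := norm_add_le (F ξ) (F (ξ + w) - F ξ)
  rw [add_sub_cancel] at this
  rw [hzw]
  linarith

/-- Pointwise limits along an ultrafilter of locally bounded holomorphic functions exist and are
holomorphic: Montel's theorem without subsequences. -/
theorem exists_holomorphic_limit {ι : Type*} (𝒰 : Ultrafilter ι) {F : ι → ℂ → ℂ} {U : Set ℂ}
    (h : ∀ z₀ ∈ U, ∃ δ > 0, ∃ B : ℝ, ∀ᶠ n in (𝒰 : Filter ι),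
      DifferentiableOn ℂ (F n) (Metric.ball z₀ δ) ∧ ∀ z ∈ Metric.ball z₀ δ, ‖F n z‖ ≤ B) :
    ∃ G : ℂ → ℂ, DifferentiableOn ℂ G U ∧
      ∀ z ∈ U, Tendsto (fun n => F n z) 𝒰 (𝓝 (G z)) := by
  have hex (z : ℂ) : ∃ L : ℂ, (∃ B : ℝ, ∀ᶠ n in (𝒰 : Filter ι), ‖F n z‖ ≤ B) →
      Tendsto (fun n => F n z) 𝒰 (𝓝 L) := by
    by_cases hB : ∃ B : ℝ, ∀ᶠ n in (𝒰 : Filter ι), ‖F n z‖ ≤ B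
    · obtain ⟨B, hB⟩ := hB
      obtain ⟨L, hL⟩ := exists_tendsto_ultrafilter 𝒰 (a := fun n => F n z) (c := 0) (R := B)
        (by simpa only [dist_zero_right] using hB)
      exact ⟨L, fun _ => hL⟩
    · exact ⟨0, fun h => absurd h hB⟩
  choose G hG using hex
  refine ⟨G, fun z₀ hz₀ => ?_, fun z hz => ?_⟩
  swap
  · obtain ⟨δ, hδ, B, hB⟩ := h z hz
    exact hG z ⟨B, hB.mono fun n hn => hn.2 z (Metric.mem_ball_self hδ)⟩
  obtain ⟨δ, hδ, B, hB⟩ := h z₀ hz₀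
  have hB0 : 0 ≤ B := by
    obtain ⟨n, hn⟩ := hB.exists
    exact (norm_nonneg _).trans (hn.2 z₀ (Metric.mem_ball_self hδ))
  have hlim {z : ℂ} (hz : z ∈ Metric.ball z₀ δ) : Tendsto (fun n => F n z) 𝒰 (𝓝 (G z)) :=
    hG z ⟨B, hB.mono fun n hn => hn.2 z hz⟩
  -- equicontinuity on a smaller ball, by Cauchy's estimate
  set L : ℝ := B / (δ / 4) with hL
  have hL0 : 0 ≤ L := by positivity
  have hsub : Metric.closedBall z₀ (δ / 2) ⊆ Metric.ball z₀ δ :=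
    Metric.closedBall_subset_ball (half_lt_self hδ)
  have hLip : ∀ᶠ n in (𝒰 : Filter ι), ∀ z ∈ Metric.closedBall z₀ (δ / 2),
      ∀ w ∈ Metric.closedBall z₀ (δ / 2), ‖F n w - F n z‖ ≤ L * ‖w - z‖ := by
    filter_upwards [hB] with n hn z hz w hw
    refine (convex_closedBall z₀ (δ / 2)).norm_image_sub_le_of_norm_deriv_le (𝕜 := ℂ)
      (fun x hx => hn.1.differentiableAt (Metric.isOpen_ball.mem_nhds (hsub hx)))
      (fun x hx => ?_) hz hw
    have hin : Metric.closedBall x (δ / 4) ⊆ Metric.ball z₀ δ := by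
      refine Metric.closedBall_subset_ball' ?_
      have := Metric.mem_closedBall.1 hx
      linarith
    refine Complex.norm_deriv_le_of_forall_mem_sphere_norm_le (by positivity)
      (DifferentiableOn.diffContOnCl ?_)
      fun y hy => hn.2 y (hin (Metric.sphere_subset_closedBall hy))
    rw [closure_ball _ (by positivity)]
    exact hn.1.mono hin
  have hGLip {z w : ℂ} (hz : z ∈ Metric.closedBall z₀ (δ / 2))
      (hw : w ∈ Metric.closedBall z₀ (δ / 2)) : ‖G w - G z‖ ≤ L * ‖w - z‖ :=
    le_of_tendsto ((hlim (hsub hw)).sub (hlim (hsub hz))).norm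
      (hLip.mono fun n hn => hn z hz w hw)
  have hunif : TendstoUniformlyOn F G 𝒰 (Metric.closedBall z₀ (δ / 2)) := by
    rw [Metric.tendstoUniformlyOn_iff]
    intro ε hε
    obtain ⟨t, hts, htf, htc⟩ := (isCompact_closedBall z₀ (δ / 2)).finite_cover_balls
      (e := ε / (4 * (L + 1))) (by positivity)
    have hfin : ∀ᶠ n in (𝒰 : Filter ι), ∀ y ∈ t, dist (F n y) (G y) < ε / 4 :=
      (eventually_all_finite htf).2 fun y hy =>
        (Metric.tendsto_nhds.1 (hlim (hsub (hts hy)))) _ (by positivity)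
    filter_upwards [hfin, hLip] with n hn1 hn2 x hx
    obtain ⟨y, hy, hxy⟩ := Set.mem_iUnion₂.1 (htc hx)
    rw [mem_ball_iff_norm] at hxy
    have h1 := hn2 y (hts hy) x hx
    have h2 := hGLip (hts hy) hx
    have h3 := hn1 y hy
    rw [dist_eq_norm] at h3
    have h4 : L * ‖x - y‖ ≤ ε / 4 := by
      calc L * ‖x - y‖ ≤ (L + 1) * (ε / (4 * (L + 1))) :=
            mul_le_mul (by linarith) hxy.le (norm_nonneg _) (by linarith)
        _ = ε / 4 := by field_simp
    rw [dist_eq_norm]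
    have e : G x - F n x = (G x - G y) - (F n y - G y) - (F n x - F n y) := by ring
    rw [e]
    have h5 := norm_sub_le ((G x - G y) - (F n y - G y)) (F n x - F n y)
    have h6 := norm_sub_le (G x - G y) (F n y - G y)
    linarith
  have hdiff : DifferentiableOn ℂ G (Metric.ball z₀ (δ / 2)) :=
    (hunif.mono Metric.ball_subset_closedBall).tendstoLocallyUniformlyOn.differentiableOn
      (hB.mono fun n hn => hn.1.mono (Metric.ball_subset_ball (by linarith))) Metric.isOpen_ball
  exact (hdiff.differentiableAt (Metric.ball_mem_nhds z₀ (half_pos hδ))).differentiableWithinAt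

/-- Limits in the classes `K_a`: if the limit of the widths is at least `a`, then a pointwise limit
on the real axis of uniformly bounded functions belongs to `K_a`. -/
theorem inK_of_tendsto (𝒰 : Ultrafilter ℕ) {f : ℕ → ℝ → ℝ} {C : ℝ} (hC : ∀ n x, |f n x| ≤ C)
    {f₀ : ℝ → ℝ} (hf₀ : ∀ x, Tendsto (fun n => f n x) 𝒰 (𝓝 (f₀ x))) {a : ℝ} (ha : 0 < a)
    {α : ℕ → ℝ} (hα : ∀ a' < a, ∀ᶠ n in (𝒰 : Filter ℕ), a' < α n)
    (hK : ∀ᶠ n in (𝒰 : Filter ℕ), InK (α n) (f n)) : InK a f₀ := by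
  have hex (n : ℕ) : ∃ F : ℂ → ℂ, InK (α n) (f n) →
      DifferentiableOn ℂ F {z : ℂ | |z.im| < α n} ∧ (∀ x : ℝ, F (x : ℂ) = (f n x : ℂ)) ∧
        ∀ z : ℂ, |z.im| < α n → 0 ≤ (F z).im * z.im := by
    by_cases h : InK (α n) (f n)
    · obtain ⟨-, F, hF⟩ := h
      exact ⟨F, fun _ => hF⟩
    · exact ⟨0, fun h' => absurd h' h⟩
  choose F hF using hex
  obtain ⟨G, hGd, hGl⟩ := exists_holomorphic_limit 𝒰 (F := F) (U := {z : ℂ | |z.im| < a}) (by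
    intro z₀ hz₀
    have hz₀' : |z₀.im| < a := hz₀
    set a' : ℝ := (|z₀.im| + a) / 2 with ha'
    obtain ⟨δ, hδ, B, hB⟩ := exists_local_bound (a := a') (z₀ := z₀) (by linarith) C
    refine ⟨δ, hδ, B, ?_⟩
    filter_upwards [hα a' (by linarith), hK] with n hn1 hn2
    obtain ⟨h1, h2, h3⟩ := hF n hn2
    have hB' := hB (f n) (F n) (hC n) (h1.mono fun z hz => lt_trans hz hn1) h2
      fun z hz => h3 z (lt_trans hz hn1)
    exact ⟨h1.mono fun z hz => (hB' z hz).1.trans hn1, fun z hz => (hB' z hz).2⟩)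
  refine ⟨⟨C, fun x => ?_⟩, G, hGd, fun x => ?_, fun z hz => ?_⟩
  · exact le_of_tendsto' (hf₀ x).abs fun n => hC n x
  · have h1 := hGl (x : ℂ) (by simpa using ha)
    have h2 : Tendsto (fun n => ((f n x : ℝ) : ℂ)) 𝒰 (𝓝 ((f₀ x : ℝ) : ℂ)) :=
      (Complex.continuous_ofReal.tendsto _).comp (hf₀ x)
    refine tendsto_nhds_unique h1 (h2.congr' ?_)
    filter_upwards [hK] with n hn
    exact ((hF n hn).2.1 x).symm
  · have h1 := ((Complex.continuous_im.tendsto _).comp (hGl z hz)).mul_const z.im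
    refine ge_of_tendsto h1 ?_
    filter_upwards [hα _ hz, hK] with n hn1 hn2
    exact (hF n hn2).2.2 z hn1

/-- A bounded function that belongs to the classes `K_a` for all `a` is constant. As the radius
tends to infinity, the Harnack-type estimate shows that it is affine. -/
theorem constant_of_forall_inK {f : ℝ → ℝ} (h : ∀ a, 0 < a → InK a f) (x y : ℝ) : f x = f y := by
  obtain ⟨C, hC⟩ := (h 1 one_pos).1
  have key (w : ℝ) (hw : w ≠ 0) : f (x + w) - f x = deriv f x * w := by
    have hbound : ∀ᶠ n : ℕ in atTop, |(1 - w ^ 2 / (n : ℝ) ^ 2) * ((f (x + w) - f x) / w) -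
        deriv f x| ≤ 2 * (deriv f x + 1 / (n : ℝ) ^ 2) * |w| / ((n : ℝ) - |w|) := by
      filter_upwards [tendsto_natCast_atTop_atTop.eventually_gt_atTop |w|] with n hn
      have hn0 : (0 : ℝ) < n := (abs_nonneg w).trans_lt hn
      obtain ⟨-, F, hF, hFf, hpos⟩ := h ((n : ℝ) + 1) (by positivity)
      have hder := hasDerivAt_of_real hF (by positivity) hFf x
      have hre : (F x).im = 0 := by rw [hFf, Complex.ofReal_im]
      have hw' : (w : ℂ) ≠ 0 := Complex.ofReal_ne_zero.2 hw
      have hwn : ‖(w : ℂ)‖ < n := by rwa [Complex.norm_real]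
      have hDnn := nonneg_of_hasDerivAt (by positivity) hF hpos hre hder.2
      have hmain := norm_mul_slope_sub_le hF hpos hre hder.2 hn0 (lt_add_one _) hwn hw'
        (M := (n : ℝ) ^ 2 * deriv f x + 1) (by positivity) (by linarith)
      rw [← Complex.ofReal_add, hFf, hFf] at hmain
      have e : ((n : ℝ) : ℂ) ^ 2 = (((n : ℝ) ^ 2 : ℝ) : ℂ) := by push_cast; rfl
      rw [e, ← Complex.ofReal_pow, ← Complex.ofReal_sub, ← Complex.ofReal_sub,
        ← Complex.ofReal_div, ← Complex.ofReal_mul, ← Complex.ofReal_mul, ← Complex.ofReal_sub,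
        Complex.norm_real, Complex.norm_real, Real.norm_eq_abs, Real.norm_eq_abs] at hmain
      have e2 : (1 - w ^ 2 / (n : ℝ) ^ 2) * ((f (x + w) - f x) / w) - deriv f x =
          (((n : ℝ) ^ 2 - w ^ 2) * ((f (x + w) - f x) / w) - (n : ℝ) ^ 2 * deriv f x) /
            (n : ℝ) ^ 2 := by
        field_simp
      rw [e2, abs_div, abs_of_pos (pow_pos hn0 2), div_le_iff₀ (pow_pos hn0 2)]
      refine hmain.trans (le_of_eq ?_)
      field_simp
    have hsq : Tendsto (fun n : ℕ => (n : ℝ) ^ 2) atTop atTop :=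
      (tendsto_pow_atTop two_ne_zero).comp tendsto_natCast_atTop_atTop
    have hl : Tendsto (fun n : ℕ => |(1 - w ^ 2 / (n : ℝ) ^ 2) * ((f (x + w) - f x) / w) -
        deriv f x|) atTop (𝓝 |(1 - 0) * ((f (x + w) - f x) / w) - deriv f x|) :=
      (((tendsto_const_nhds.sub (tendsto_const_nhds.div_atTop hsq)).mul_const _).sub_const _).abs
    have hr : Tendsto (fun n : ℕ => 2 * (deriv f x + 1 / (n : ℝ) ^ 2) * |w| / ((n : ℝ) - |w|))
        atTop (𝓝 0) := by
      have h1 : Tendsto (fun n : ℕ => 2 * (deriv f x + 1 / (n : ℝ) ^ 2) * |w|) atTop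
          (𝓝 (2 * (deriv f x + 0) * |w|)) :=
        ((tendsto_const_nhds.add (tendsto_const_nhds.div_atTop hsq)).const_mul 2).mul_const _
      exact h1.div_atTop (tendsto_atTop_add_const_right _ (-|w|) tendsto_natCast_atTop_atTop)
    have h0 := le_of_tendsto_of_tendsto hl hr hbound
    have h1 : (f (x + w) - f x) / w = deriv f x := by
      have := abs_nonpos_iff.1 h0
      linarith
    rw [← h1, div_mul_cancel₀ _ hw]
  -- a bounded affine function is constant
  have hD : deriv f x = 0 := by
    by_contra hne
    have h1 := key ((2 * C + 1) / deriv f x)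
      (div_ne_zero (by linarith [(abs_nonneg _).trans (hC 0)]) hne)
    rw [mul_div_cancel₀ _ hne] at h1
    have h2 := (abs_le.1 (hC (x + (2 * C + 1) / deriv f x))).2
    have h3 := (abs_le.1 (hC x)).1
    linarith
  rcases eq_or_ne y x with rfl | hyx
  · rfl
  · have := key (y - x) (sub_ne_zero.2 hyx)
    rw [hD, zero_mul, add_sub_cancel] at this
    linarith

/-! ### The reduction -/

theorem form_eq_zero_of_right_const {f g : ℝ → ℝ} (hf : BddMeas f) (hg : BddMeas g) {c : ℝ}
    (h : g =ᵐ[volume] fun _ => c) (φ : L2R) : form f g hf hg φ = 0 := by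
  rw [form_eq_integral, ← mul_zero c, ← integral_density hf φ, ← integral_const_mul]
  refine integral_congr_ae ?_
  filter_upwards [h] with x hx
  rw [hx]

theorem form_eq_zero_of_left_const {f g : ℝ → ℝ} (hf : BddMeas f) (hg : BddMeas g) {c : ℝ}
    (h : f =ᵐ[volume] fun _ => c) (φ : L2R) : form f g hf hg φ = 0 := by
  rw [form_swap]
  exact form_eq_zero_of_right_const _ _ (c := c) (dilate_congr h) _

theorem IsEntire.continuous {f : ℝ → ℝ} (hf : IsEntire f) : Continuous f := by
  obtain ⟨F, hF, hFf⟩ := hf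
  have : f = fun x : ℝ => (F x).re := by
    funext x
    rw [hFf, Complex.ofReal_re]
  rw [this]
  exact Complex.continuous_re.comp (hF.continuous.comp Complex.continuous_ofReal)

theorem IsEntire.neg {f : ℝ → ℝ} (hf : IsEntire f) : IsEntire fun x => -f x := by
  obtain ⟨F, hF, hFf⟩ := hf
  exact ⟨fun z => -F z, hF.neg, fun x => by simp [hFf]⟩

/-- For continuous functions the identification almost everywhere is vacuous. -/
theorem AEInK.inK {a : ℝ} (ha : 0 < a) {f : ℝ → ℝ} (h : AEInK a f) (hf : Continuous f) :
    InK a f := by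
  obtain ⟨f₀, hf₀, he⟩ := h
  obtain ⟨-, F, hF, hFf, -⟩ := id hf₀
  have hc : Continuous f₀ := continuous_iff_continuousAt.2 fun x =>
    (hasDerivAt_of_real hF ha hFf x).1.continuousAt
  rwa [(Continuous.ae_eq_iff_eq volume hf hc).1 he]

theorem AEInK.congr {a : ℝ} {f g : ℝ → ℝ} (h : AEInK a f) (hfg : g =ᵐ[volume] f) : AEInK a g := by
  obtain ⟨f₀, hf₀, he⟩ := h
  exact ⟨f₀, hf₀, hfg.trans he⟩

/-- Passage to the limit in the conclusion of the conjecture. If the widths of the strips do not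
converge to positive numbers, then one of them is unbounded, and that limit is constant. -/
theorem exists_strips_of_tendsto (𝒰 : Ultrafilter ℕ) (h𝒰 : (𝒰 : Filter ℕ) ≤ atTop)
    {f g : ℕ → ℝ → ℝ} {C D : ℝ} (hC : ∀ n x, |f n x| ≤ C) (hD : ∀ n x, |g n x| ≤ D)
    {f₀ g₀ : ℝ → ℝ} (hf₀ : ∀ᵐ x, Tendsto (fun n => f n x) atTop (𝓝 (f₀ x)))
    (hg₀ : ∀ᵐ x, Tendsto (fun n => g n x) atTop (𝓝 (g₀ x))) {α β : ℕ → ℝ}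
    (h : ∀ᶠ n in (𝒰 : Filter ℕ), 0 < α n ∧ 0 < β n ∧ α n * β n = Real.pi / 2 ∧
      InK (α n) (f n) ∧ InK (β n) (g n)) :
    (∃ c, f₀ =ᵐ[volume] fun _ => c) ∨ (∃ c, g₀ =ᵐ[volume] fun _ => c) ∨
      ∃ a b : ℝ, 0 < a ∧ 0 < b ∧ a * b = Real.pi / 2 ∧ AEInK a f₀ ∧ AEInK b g₀ := by
  have hlim {f : ℕ → ℝ → ℝ} {C : ℝ} (hC : ∀ n x, |f n x| ≤ C) {f₀ : ℝ → ℝ}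
      (hf₀ : ∀ᵐ x, Tendsto (fun n => f n x) atTop (𝓝 (f₀ x))) :
      ∃ f₁ : ℝ → ℝ, (∀ x, Tendsto (fun n => f n x) 𝒰 (𝓝 (f₁ x))) ∧ f₀ =ᵐ[volume] f₁ := by
    have (x : ℝ) := exists_tendsto_ultrafilter 𝒰 (a := fun n => f n x) (c := 0) (R := C)
      (Eventually.of_forall fun n => by rw [dist_zero_right, Real.norm_eq_abs]; exact hC n x)
    choose f₁ hf₁ using this
    exact ⟨f₁, hf₁, hf₀.mono fun x hx => tendsto_nhds_unique (hx.mono_left h𝒰) (hf₁ x)⟩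
  obtain ⟨f₁, hf₁, hff₁⟩ := hlim hC hf₀
  obtain ⟨g₁, hg₁, hgg₁⟩ := hlim hD hg₀
  by_cases hα : ∀ R, ∀ᶠ n in (𝒰 : Filter ℕ), R < α n
  · refine Or.inl ⟨f₁ 0, hff₁.trans (Eventually.of_forall fun x => ?_)⟩
    exact constant_of_forall_inK (fun a ha => inK_of_tendsto 𝒰 hC hf₁ ha (fun a' _ => hα a')
      (h.mono fun n hn => hn.2.2.2.1)) x 0
  by_cases hβ : ∀ R, ∀ᶠ n in (𝒰 : Filter ℕ), R < β n
  · refine Or.inr (Or.inl ⟨g₁ 0, hgg₁.trans (Eventually.of_forall fun x => ?_)⟩)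
    exact constant_of_forall_inK (fun a ha => inK_of_tendsto 𝒰 hD hg₁ ha (fun a' _ => hβ a')
      (h.mono fun n hn => hn.2.2.2.2)) x 0
  have hwidth {α : ℕ → ℝ} (hpos : ∀ᶠ n in (𝒰 : Filter ℕ), 0 < α n)
      (hα : ¬∀ R, ∀ᶠ n in (𝒰 : Filter ℕ), R < α n) : ∃ a, 0 ≤ a ∧ Tendsto α 𝒰 (𝓝 a) := by
    obtain ⟨R, hR⟩ := not_forall.1 hα
    rw [← Ultrafilter.eventually_not] at hR
    obtain ⟨a, ha⟩ := exists_tendsto_ultrafilter 𝒰 (a := α) (c := 0) (R := R) (by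
      filter_upwards [hR, hpos] with n h1 h2
      rw [dist_zero_right, Real.norm_eq_abs, abs_of_pos h2]
      exact not_lt.1 h1)
    exact ⟨a, ge_of_tendsto ha (hpos.mono fun n hn => hn.le), ha⟩
  obtain ⟨a, ha0, ha⟩ := hwidth (h.mono fun n hn => hn.1) hα
  obtain ⟨b, hb0, hb⟩ := hwidth (h.mono fun n hn => hn.2.1) hβ
  have hab : a * b = Real.pi / 2 := tendsto_nhds_unique (ha.mul hb)
    (tendsto_const_nhds.congr' (h.mono fun n hn => hn.2.2.1.symm))
  have hab0 : a * b ≠ 0 := by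
    rw [hab]
    exact (half_pos Real.pi_pos).ne'
  have ha1 : 0 < a := lt_of_le_of_ne ha0 (Ne.symm (left_ne_zero_of_mul hab0))
  have hb1 : 0 < b := lt_of_le_of_ne hb0 (Ne.symm (right_ne_zero_of_mul hab0))
  exact Or.inr (Or.inr ⟨a, b, ha1, hb1, hab,
    ⟨f₁, inK_of_tendsto 𝒰 hC hf₁ ha1 (fun a' h' => ha.eventually (lt_mem_nhds h'))
      (h.mono fun n hn => hn.2.2.2.1), hff₁⟩,
    ⟨g₁, inK_of_tendsto 𝒰 hD hg₁ hb1 (fun b' h' => hb.eventually (lt_mem_nhds h'))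
      (h.mono fun n hn => hn.2.2.2.2), hgg₁⟩⟩)

theorem ae_tendsto_mollifier {f : ℝ → ℝ} (hf : Monotone f) {C : ℝ} (hC : ∀ x, |f x| ≤ C) :
    ∀ᵐ x, Tendsto (fun n : ℕ => mollify f (mollifier (1 / ((n : ℝ) + 1))) x) atTop (𝓝 (f x)) := by
  filter_upwards [hf.countable_not_continuousAt.ae_notMem volume] with x hx
  exact tendsto_mollify_map hf.measurable hC gaussCauchy tendsto_one_div_add_atTop_nhds_zero_nat
    (not_not.1 hx)

/-- The reduction for nondecreasing symbols: the hypothesis applies to the mollified symbols, and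
its conclusion passes to the limit. -/
theorem katoConclusion_of_monotone
    (hKato : ∀ (f g : ℝ → ℝ) (hf : BddMeas f) (hg : BddMeas g), IsEntire f → IsEntire g →
      (∃ a : ℝ, 0 < a ∧ InK a f) → (∃ b : ℝ, 0 < b ∧ InK b g) →
      (commK f g hf hg).IsPositive → commK f g hf hg ≠ 0 → KatoConclusion f g)
    {f g : ℝ → ℝ} (hfm : Monotone f) (hgm : Monotone g) {C D : ℝ} (hC : ∀ x, |f x| ≤ C)
    (hD : ∀ x, |g x| ≤ D) (hf : BddMeas f) (hg : BddMeas g)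
    (hpos : ∀ φ, 0 ≤ form f g hf hg φ) (hne : ∃ φ, form f g hf hg φ ≠ 0) :
    KatoConclusion f g := by
  let ε (n : ℕ) : ℝ := 1 / ((n : ℝ) + 1)
  have hε (n : ℕ) : 0 < ε n := by positivity
  let F (n : ℕ) : ℝ → ℝ := mollify f (mollifier (ε n))
  let G (n : ℕ) : ℝ → ℝ := mollify g (mollifier (ε n))
  have hF (n : ℕ) : BddMeas (F n) := bddMeas_mollify hfm.measurable hC _
  have hG (n : ℕ) : BddMeas (G n) := bddMeas_mollify hgm.measurable hD _
  have hFC (n : ℕ) (x : ℝ) : |F n x| ≤ C := abs_mollify_le hC _ x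
  have hGD (n : ℕ) (x : ℝ) : |G n x| ≤ D := abs_mollify_le hD _ x
  have hFe (n : ℕ) : IsEntire (F n) := isEntire_mollifier hfm.measurable hC (hε n)
  have hGe (n : ℕ) : IsEntire (G n) := isEntire_mollifier hgm.measurable hD (hε n)
  have hFl : ∀ᵐ x, Tendsto (fun n => F n x) atTop (𝓝 (f x)) := ae_tendsto_mollifier hfm hC
  have hGl : ∀ᵐ x, Tendsto (fun n => G n x) atTop (𝓝 (g x)) := ae_tendsto_mollifier hgm hD
  obtain ⟨φ, hφ⟩ := hne
  have hev : ∀ᶠ n in atTop, KatoConclusion (F n) (G n) := by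
    filter_upwards [(tendsto_form hf hg hF hG hFC hGD hFl hGl φ).eventually_ne hφ] with n hn
    refine hKato (F n) (G n) (hF n) (hG n) (hFe n) (hGe n) (exists_inK_mollifier hfm hC (hε n))
      (exists_inK_mollifier hgm hD (hε n)) ?_ ?_
    · rw [commK_isPositive_iff]
      exact form_mollify_nonneg hf hg hfm.measurable hgm.measurable _ _ _ _ hpos
    · rw [Ne, commK_eq_zero_iff]
      exact fun h => hn (h φ)
  have h𝒰 : (hyperfilter ℕ : Filter ℕ) ≤ atTop := by
    rw [← Nat.cofinite_eq_atTop]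
    exact hyperfilter_le_cofinite
  have hex (n : ℕ) : ∃ a b : ℝ, KatoConclusion (F n) (G n) → 0 < a ∧ 0 < b ∧ a * b = Real.pi / 2 ∧
      ((AEInK a (F n) ∧ AEInK b (G n)) ∨
        (AEInK a (fun x => -F n x) ∧ AEInK b (fun x => -G n x))) := by
    by_cases h : KatoConclusion (F n) (G n)
    · obtain ⟨a, b, hab⟩ := h
      exact ⟨a, b, fun _ => hab⟩
    · exact ⟨0, 0, fun h' => absurd h' h⟩
  choose α β hαβ using hex
  -- the sign alternative is constant along the ultrafilter
  have hor : ∀ᶠ n in (hyperfilter ℕ : Filter ℕ),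
      (0 < α n ∧ 0 < β n ∧ α n * β n = Real.pi / 2 ∧ InK (α n) (F n) ∧ InK (β n) (G n)) ∨
      (0 < α n ∧ 0 < β n ∧ α n * β n = Real.pi / 2 ∧ InK (α n) (fun x => -F n x) ∧
        InK (β n) (fun x => -G n x)) := by
    filter_upwards [hev.filter_mono h𝒰] with n hn
    obtain ⟨ha, hb, hab, ⟨h1, h2⟩ | ⟨h1, h2⟩⟩ := hαβ n hn
    · exact Or.inl ⟨ha, hb, hab, h1.inK ha (hFe n).continuous, h2.inK hb (hGe n).continuous⟩
    · exact Or.inr ⟨ha, hb, hab, h1.inK ha (hFe n).neg.continuous,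
        h2.inK hb (hGe n).neg.continuous⟩
  rcases Ultrafilter.eventually_or.1 hor with h | h
  · rcases exists_strips_of_tendsto _ h𝒰 hFC hGD hFl hGl h with
      ⟨c, hc⟩ | ⟨c, hc⟩ | ⟨a, b, ha, hb, hab, h1, h2⟩
    · exact absurd (form_eq_zero_of_left_const hf hg hc φ) hφ
    · exact absurd (form_eq_zero_of_right_const hf hg hc φ) hφ
    · exact ⟨a, b, ha, hb, hab, Or.inl ⟨h1, h2⟩⟩
  · rw [← form_neg_neg] at hφ
    rcases exists_strips_of_tendsto _ h𝒰 (fun n x => by rw [abs_neg]; exact hFC n x)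
      (fun n x => by rw [abs_neg]; exact hGD n x) (hFl.mono fun x hx => hx.neg)
      (hGl.mono fun x hx => hx.neg) h with
      ⟨c, hc⟩ | ⟨c, hc⟩ | ⟨a, b, ha, hb, hab, h1, h2⟩
    · exact absurd (form_eq_zero_of_left_const hf.neg hg.neg hc φ) hφ
    · exact absurd (form_eq_zero_of_right_const hf.neg hg.neg hc φ) hφ
    · exact ⟨a, b, ha, hb, hab, Or.inr ⟨h1, h2⟩⟩

end KatoCommutator

end

theorem theorem6
    (hKato : ∀ (f g : ℝ → ℝ) (hf : KatoCommutator.BddMeas f) (hg : KatoCommutator.BddMeas g),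
      KatoCommutator.IsEntire f → KatoCommutator.IsEntire g →
      (∃ a : ℝ, 0 < a ∧ KatoCommutator.InK a f) →
      (∃ b : ℝ, 0 < b ∧ KatoCommutator.InK b g) →
      (KatoCommutator.commK f g hf hg).IsPositive →
      KatoCommutator.commK f g hf hg ≠ 0 →
      KatoCommutator.KatoConclusion f g) :
    ∀ (f g : ℝ → ℝ) (hf : KatoCommutator.BddMeas f) (hg : KatoCommutator.BddMeas g),
      (KatoCommutator.commK f g hf hg).IsPositive →
      KatoCommutator.commK f g hf hg ≠ 0 →
      KatoCommutator.KatoConclusion f g := by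
  open KatoCommutator in
  intro f g hf hg hK hK0
  rw [commK_isPositive_iff] at hK
  rw [Ne, commK_eq_zero_iff, not_forall] at hK0
  obtain ⟨f₀, g₀, hf₀, hg₀, ⟨C, hC⟩, ⟨D, hD⟩, h⟩ := exists_monotone_pair hf hg hK hK0
  have bf : BddMeas f₀ := ⟨hf₀.measurable.aemeasurable, C, hC⟩
  have bg : BddMeas g₀ := ⟨hg₀.measurable.aemeasurable, D, hD⟩
  have hneg {u v : ℝ → ℝ} (h : (fun x => -u x) =ᵐ[volume] v) : u =ᵐ[volume] fun x => -v x := by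
    filter_upwards [h] with x hx
    rw [← hx, neg_neg]
  have hform (φ : L2R) : form f g hf hg φ = form f₀ g₀ bf bg φ := by
    rcases h with ⟨h1, h2⟩ | ⟨h1, h2⟩
    · exact form_congr hf hg bf bg h1 h2 φ
    · rw [← form_neg_neg]
      exact form_congr hf.neg hg.neg bf bg h1 h2 φ
  obtain ⟨α, β, hα, hβ, hαβ, hsign⟩ := katoConclusion_of_monotone hKato hf₀ hg₀ hC hD bf bg
    (fun φ => hform φ ▸ hK φ) (hK0.imp fun φ h => hform φ ▸ h)
  refine ⟨α, β, hα, hβ, hαβ, ?_⟩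
  rcases h with ⟨h1, h2⟩ | ⟨h1, h2⟩
  · exact hsign.imp (fun hs => ⟨hs.1.congr h1, hs.2.congr h2⟩)
      fun hs => ⟨hs.1.congr h1.neg, hs.2.congr h2.neg⟩
  · exact hsign.symm.imp (fun hs => ⟨hs.1.congr (hneg h1), hs.2.congr (hneg h2)⟩)
      fun hs => ⟨hs.1.congr h1, hs.2.congr h2⟩
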